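/- Let $K$ be a field; $\otimes=\otimes_K$. **Conventions.** For a linear map $\alpha:V\otimes V\to W$ write $\alpha_1=\alpha\otimes V$ and $\alpha_2=V\otimes\alpha$ (maps on $V\otimes V\otimes V$). A braided vector space is a pair $(V,c)$ with $c:V\otimes V\to V\otimes V$ linear and $c_1c_2c_1=c_2c_1c_2$; it is of Hecke type of mark $\lambda\in K$ if $(c+\mathrm{Id})(c-\lambda\,\mathrm{Id})=0$. A ($c$-)bracket on $(V,c)$ is a linear map $b:V\otimes V\to V$ with $cb_1=b_2c_1c_2$ and $cb_2=b_1c_2c_1$; a morphism of braided brackets $(V,c,b)\to(V',c',b')$ is a linear map $f$ with $c'(f\otimes f)=(f\otimes f)c$ and $fb=b'(f\otimes f)$. A braided bialgebra $(A,\nabla,1,\Delta,\varepsilon,c_A)$ is a braided vector space $(A,c_A)$ with an associative unital algebra structure and a coassociative counital coalgebra structure, such that: * $c_A(\nabla\otimes A)=(A\otimes\nabla)(c_A\otimes A)(A\otimes c_A)$, $c_A(A\otimes\nabla)=(\nabla\otimes A)(A\otimes c_A)(c_A\otimes A)$, $c_A(1\otimes a)=a\otimes1$, $c_A(a\otimes1)=1\otimes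 a$; * $(A\otimes\Delta)c_A=(c_A\otimes A)(A\otimes c_A)(\Delta\otimes A)$, $(\Delta\otimes A)c_A=(A\otimes c_A)(c_A\otimes A)(A\otimes\Delta)$, $(\varepsilon\otimes A)c_A(x\otimes y)=\varepsilon(y)x=(A\otimes\varepsilon)c_A(y\otimes x)$; * $\varepsilon$ and $\Delta$ are unital algebra maps, where $A\otimes A$ has the multiplication $(\nabla\otimes\nabla)(A\otimes c_A\otimes A)$. Morphisms of braided bialgebras are unital algebra maps compatible with comultiplications, counits and braidings. $A$ is connected if its coradical (the sum of its simple subcoalgebras) is one-dimensional. The space of primitive elements is $P=P(A)=\{x\in A:\Delta(x)=x\otimes1+1\otimes x\}$; then $c_A$ restricts to a map $c_P:P\otimes P\to P\otimes P$, the infinitesimal braiding of $A$. If $c_P$ is of Hecke type of mark $\lambda$, then $\nabla(c_P-\lambda\,\mathrm{Id})$ maps $P\otimes P$ into $P$, and $b_P=\nabla(c_P-\lambda\,\mathrm{Id}):P\otimes P\to P$ is the canonical bracket. For a braided vector space $(V,c)$, $T(V,c)$ is the tensor algebra with the braiding $c_T$ that moves a word across a word letter by letter by means of $c$, with the comultiplication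 that is the algebra map with $\Delta_T(v)=v\otimes1+1\otimes v$ and with the counit that is the algebra map with $\varepsilon_T(v)=0$ $(v\in V)$. For $c$ of Hecke type of mark $\lambda$ and a $c$-bracket $b$, the enveloping algebra $U(V,c,b)$ is the quotient of $T(V,c)$ by the two-sided ideal generated by all $c(z)-\lambda z-b(z)$, $z\in V\otimes V$, with the induced structure. Finally $(n)_\lambda=1+\lambda+\dots+\lambda^{n-1}$ and $(3)!_\lambda=(1)_\lambda(2)_\lambda(3)_\lambda$. **Proposition.** Let $\operatorname{char}K\neq2$ and let $A$ be a connected braided bialgebra whose infinitesimal braiding $c_P$ is of Hecke type of mark $\lambda$, where $\lambda\neq0,1$ and $(3)!_\lambda\neq0$. Then $b_P=0$. Moreover, let $(V,c)$ be a braided vector space of Hecke type of the same mark $\lambda$ and let $b$ be a $c$-bracket on it. Then the structure of $T(V,c)$ induces a structure of braided bialgebra on $U(V,c,b)$ for which the canonical projection $T(V,c)\to U(V,c,b)$ is a morphism of braided bialgebras, and for every morphism of braided brackets $f:(V,c,b)\to(P,c_P,0)$ there is a unique morphism of braided bialgebras $\widetilde f:U(V,c,b)\to A$ that lifts $f$,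 that is, whose composite with the canonical map $V\to U(V,c,b)$ is $f$ followed by the inclusion $P\subseteq A$. -/

import Mathlib

open scoped TensorProduct
open TensorProduct

noncomputable section

namespace Braided

/-! ### Braidings, Hecke type, brackets -/

section BraidedSpaces

variable {K : Type*} [Field K] {V W : Type*} [AddCommGroup V] [Module K V]
  [AddCommGroup W] [Module K W]

/-- `α₁ = α ⊗ V : V ⊗ V ⊗ V → W ⊗ V` for `α : V ⊗ V → W`. -/
def onFirst (α : V ⊗[K] V →ₗ[K] W) : (V ⊗[K] V) ⊗[K] V →ₗ[K] W ⊗[K] V :=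
  LinearMap.rTensor V α

/-- `α₂ = V ⊗ α : V ⊗ V ⊗ V → V ⊗ W` for `α : V ⊗ V → W`. -/
def onLast (α : V ⊗[K] V →ₗ[K] W) : (V ⊗[K] V) ⊗[K] V →ₗ[K] V ⊗[K] W :=
  LinearMap.lTensor V α ∘ₗ (TensorProduct.assoc K V V V).toLinearMap

/-- `c₁ = c ⊗ V` on `V ⊗ V ⊗ V`. -/
def cOne (c : V ⊗[K] V →ₗ[K] V ⊗[K] V) :
    (V ⊗[K] V) ⊗[K] V →ₗ[K] (V ⊗[K] V) ⊗[K] V :=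
  onFirst c

/-- `c₂ = V ⊗ c` on `V ⊗ V ⊗ V` (bracketed to the left). -/
def cTwo (c : V ⊗[K] V →ₗ[K] V ⊗[K] V) :
    (V ⊗[K] V) ⊗[K] V →ₗ[K] (V ⊗[K] V) ⊗[K] V :=
  (TensorProduct.assoc K V V V).symm.toLinearMap ∘ₗ onLast c

/-- The braid equation `c₁ c₂ c₁ = c₂ c₁ c₂`: `(V, c)` is a braided vector space. -/
def IsBraiding (c : V ⊗[K] V →ₗ[K] V ⊗[K] V) : Prop :=
  cOne c ∘ₗ cTwo c ∘ₗ cOne c = cTwo c ∘ₗ cOne c ∘ₗ cTwo c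

/-- The map `c - q Id`. -/
def heckeDiff (c : V ⊗[K] V →ₗ[K] V ⊗[K] V) (q : K) : V ⊗[K] V →ₗ[K] V ⊗[K] V :=
  c - q • LinearMap.id

/-- `(c + Id)(c - q Id) = 0`: the map `c` is of Hecke type of mark `q`. -/
def IsHecke (c : V ⊗[K] V →ₗ[K] V ⊗[K] V) (q : K) : Prop :=
  (c + LinearMap.id) ∘ₗ heckeDiff c q = 0

/-- `c m₁ = m₂ c₁ c₂` and `c m₂ = m₁ c₂ c₁` for `m : V ⊗ V → V`. -/
def CommutesWith (c : V ⊗[K] V →ₗ[K] V ⊗[K] V) (m : V ⊗[K] V →ₗ[K] V) : Prop :=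
  c ∘ₗ onFirst m = onLast m ∘ₗ cOne c ∘ₗ cTwo c ∧
  c ∘ₗ onLast m = onFirst m ∘ₗ cTwo c ∘ₗ cOne c

/-- `b` is a `c`-bracket (braided bracket) on `(V, c)`. -/
def IsBracket (c : V ⊗[K] V →ₗ[K] V ⊗[K] V) (b : V ⊗[K] V →ₗ[K] V) : Prop :=
  CommutesWith c b

/-- `f` is a morphism of braided vector spaces: `c' (f ⊗ f) = (f ⊗ f) c`. -/
def IsBraidedHom (c : V ⊗[K] V →ₗ[K] V ⊗[K] V) (c' : W ⊗[K] W →ₗ[K] W ⊗[K] W)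
    (f : V →ₗ[K] W) : Prop :=
  c' ∘ₗ TensorProduct.map f f = TensorProduct.map f f ∘ₗ c

/-- `f : (V, c, b) → (W, c', b')` is a morphism of braided brackets. -/
def IsBracketHom (c : V ⊗[K] V →ₗ[K] V ⊗[K] V) (b : V ⊗[K] V →ₗ[K] V)
    (c' : W ⊗[K] W →ₗ[K] W ⊗[K] W) (b' : W ⊗[K] W →ₗ[K] W) (f : V →ₗ[K] W) : Prop :=
  IsBraidedHom c c' f ∧ f ∘ₗ b = b' ∘ₗ TensorProduct.map f f

end BraidedSpaces

/-- `(n)_q = 1 + q + ⋯ + q ^ (n - 1)`. -/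
def qNumber {K : Type*} [Field K] (n : ℕ) (q : K) : K := ∑ i ∈ Finset.range n, q ^ i

/-- `(n)!_q = (1)_q (2)_q ⋯ (n)_q`. -/
def qFactorial {K : Type*} [Field K] (n : ℕ) (q : K) : K :=
  ∏ i ∈ Finset.range n, qNumber (i + 1) q

/-! ### Braided bialgebras -/

section Bialgebras

variable {K : Type*} [Field K] {A : Type*} [Ring A] [Algebra K A]

/-- The multiplication `(∇ ⊗ ∇)(A ⊗ c ⊗ A)` of the braided tensor product `A ⊗_c A`. -/
def braidedMul (c : A ⊗[K] A →ₗ[K] A ⊗[K] A) :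
    A ⊗[K] A →ₗ[K] A ⊗[K] A →ₗ[K] A ⊗[K] A :=
  TensorProduct.curry
    (TensorProduct.map (LinearMap.mul' K A) (LinearMap.mul' K A) ∘ₗ
      (TensorProduct.assoc K A A (A ⊗[K] A)).symm.toLinearMap ∘ₗ
      LinearMap.lTensor A
        ((TensorProduct.assoc K A A A).toLinearMap ∘ₗ
          LinearMap.rTensor A c ∘ₗ
          (TensorProduct.assoc K A A A).symm.toLinearMap) ∘ₗ
      (TensorProduct.assoc K A A (A ⊗[K] A)).toLinearMap)

/-- `(A, ∇, 1, c)` is a braided algebra (for the given algebra structure on `A`). -/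
structure IsBraidedAlgebra (c : A ⊗[K] A →ₗ[K] A ⊗[K] A) : Prop where
  braid : IsBraiding c
  mul : CommutesWith c (LinearMap.mul' K A)
  one_left : ∀ a : A, c (1 ⊗ₜ[K] a) = a ⊗ₜ[K] 1
  one_right : ∀ a : A, c (a ⊗ₜ[K] 1) = 1 ⊗ₜ[K] a

/-- `(C, Δ, ε, c)` is a braided coalgebra. -/
structure IsBraidedCoalgebra {C : Type*} [AddCommGroup C] [Module K C]
    (c : C ⊗[K] C →ₗ[K] C ⊗[K] C) (Δ : C →ₗ[K] C ⊗[K] C) (ε : C →ₗ[K] K) : Prop where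
  braid : IsBraiding c
  coassoc : (TensorProduct.assoc K C C C).toLinearMap ∘ₗ LinearMap.rTensor C Δ ∘ₗ Δ =
    LinearMap.lTensor C Δ ∘ₗ Δ
  counit_left : ∀ x : C, LinearMap.rTensor C ε (Δ x) = 1 ⊗ₜ[K] x
  counit_right : ∀ x : C, LinearMap.lTensor C ε (Δ x) = x ⊗ₜ[K] 1
  comul_right : (TensorProduct.assoc K C C C).symm.toLinearMap ∘ₗ LinearMap.lTensor C Δ ∘ₗ c =
    cOne c ∘ₗ cTwo c ∘ₗ LinearMap.rTensor C Δ
  comul_left : LinearMap.rTensor C Δ ∘ₗ c =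
    cTwo c ∘ₗ cOne c ∘ₗ (TensorProduct.assoc K C C C).symm.toLinearMap ∘ₗ LinearMap.lTensor C Δ
  counit_braid_left : ∀ x y : C, LinearMap.rTensor C ε (c (x ⊗ₜ[K] y)) = ε y ⊗ₜ[K] x
  counit_braid_right : ∀ x y : C, LinearMap.lTensor C ε (c (y ⊗ₜ[K] x)) = x ⊗ₜ[K] ε y

variable (K A) in
/-- A braiding, a comultiplication and a counit on the algebra `A`; the axioms are in
`IsBraidedBialgebra`. -/
structure BialgebraData where
  braiding : A ⊗[K] A →ₗ[K] A ⊗[K] A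
  comul : A →ₗ[K] A ⊗[K] A
  counit : A →ₗ[K] K

/-- The axioms of a braided bialgebra `(A, ∇, 1, Δ, ε, c)`; in `comul_one` and `comul_mul`
the map `Δ : A → A ⊗_c A` is a morphism of algebras. -/
structure IsBraidedBialgebra (S : BialgebraData K A) : Prop where
  algebra : IsBraidedAlgebra S.braiding
  coalgebra : IsBraidedCoalgebra S.braiding S.comul S.counit
  comul_one : S.comul 1 = 1 ⊗ₜ[K] 1
  comul_mul : ∀ x y : A, S.comul (x * y) = braidedMul S.braiding (S.comul x) (S.comul y)
  counit_one : S.counit 1 = 1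
  counit_mul : ∀ x y : A, S.counit (x * y) = S.counit x * S.counit y

/-- The algebra map `g` is a morphism of braided bialgebras: it is also compatible with
braidings, comultiplications and counits. -/
structure IsBialgebraHom {B : Type*} [Ring B] [Algebra K B]
    (S : BialgebraData K A) (S' : BialgebraData K B) (g : A →ₐ[K] B) : Prop where
  braiding : IsBraidedHom S.braiding S'.braiding g.toLinearMap
  comul : S'.comul ∘ₗ g.toLinearMap = TensorProduct.map g.toLinearMap g.toLinearMap ∘ₗ S.comul
  counit : S'.counit ∘ₗ g.toLinearMap = S.counit

end Bialgebras

/-! ### Connected coalgebras -/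

section Connected

variable {K : Type*} [Field K] {C : Type*} [AddCommGroup C] [Module K C]

/-- `D` is a subcoalgebra: `Δ D ⊆ D ⊗ D`. -/
def IsSubcoalgebra (Δ : C →ₗ[K] C ⊗[K] C) (D : Submodule K C) : Prop :=
  ∀ x ∈ D, Δ x ∈ LinearMap.range (TensorProduct.map D.subtype D.subtype)

/-- `D` is a simple subcoalgebra. -/
def IsSimpleSubcoalgebra (Δ : C →ₗ[K] C ⊗[K] C) (D : Submodule K C) : Prop :=
  IsSubcoalgebra Δ D ∧ D ≠ ⊥ ∧ ∀ E ≤ D, IsSubcoalgebra Δ E → E = ⊥ ∨ E = D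

/-- The coradical: the sum of all simple subcoalgebras. -/
def coradical (Δ : C →ₗ[K] C ⊗[K] C) : Submodule K C :=
  sSup {D | IsSimpleSubcoalgebra Δ D}

/-- The coradical is one-dimensional. In a braided bialgebra its group-like element is `1`,
and then the condition on `c` in the definition of a connected braided coalgebra,
`c (x ⊗ 1) = 1 ⊗ x` and `c (1 ⊗ x) = x ⊗ 1`, is an axiom of braided algebras. -/
def IsConnected (Δ : C →ₗ[K] C ⊗[K] C) : Prop :=
  Module.finrank K (coradical Δ) = 1

end Connected

/-! ### Primitive elements, infinitesimal braiding and canonical bracket -/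

section Primitive

variable {K : Type*} [Field K] {A : Type*} [Ring A] [Algebra K A]

/-- The space `P` of primitive elements: `Δ x = x ⊗ 1 + 1 ⊗ x`. -/
def primitives (S : BialgebraData K A) : Submodule K A :=
  LinearMap.eqLocus S.comul ((TensorProduct.mk K A A).flip 1 + TensorProduct.mk K A A 1)

theorem mem_primitives (S : BialgebraData K A) (x : A) :
    x ∈ primitives S ↔ S.comul x = x ⊗ₜ[K] 1 + 1 ⊗ₜ[K] x := Iff.rfl

/-- The inclusion `P ⊗ P → A ⊗ A`. -/
def inclSq (S : BialgebraData K A) : primitives S ⊗[K] primitives S →ₗ[K] A ⊗[K] A :=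
  TensorProduct.map (primitives S).subtype (primitives S).subtype

theorem inclSq_injective (S : BialgebraData K A) : Function.Injective (inclSq S) :=
  TensorProduct.map_injective_of_flat_flat _ _ (primitives S).injective_subtype
    (primitives S).injective_subtype

/-- `(P ⊗ A) ∩ (A ⊗ P) = P ⊗ P` for the kernel `P` of a linear map. -/
theorem mem_range_of_ker {M N : Type*} [AddCommGroup M] [Module K M] [AddCommGroup N]
    [Module K N] (P : Submodule K M) (φ : M →ₗ[K] N) (h : P = LinearMap.ker φ) (w : M ⊗[K] M)
    (h₁ : LinearMap.rTensor M φ w = 0) (h₂ : LinearMap.lTensor M φ w = 0) :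
    w ∈ LinearMap.range (TensorProduct.map P.subtype P.subtype) := by
  have hex : Function.Exact P.subtype φ := by
    rw [LinearMap.exact_iff, Submodule.range_subtype, h]
  obtain ⟨r, hr⟩ := P.subtype.exists_leftInverse_of_injective P.ker_subtype
  obtain ⟨u, hu⟩ := (Module.Flat.rTensor_exact M hex w).1 h₁
  obtain ⟨v, hv⟩ := (Module.Flat.lTensor_exact M hex w).1 h₂
  have e₁ : LinearMap.rTensor M (P.subtype ∘ₗ r) w = w := by
    rw [← hu, ← LinearMap.comp_apply, ← LinearMap.rTensor_comp, LinearMap.comp_assoc, hr,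
      LinearMap.comp_id]
  have e₂ : LinearMap.lTensor M (P.subtype ∘ₗ r) w = w := by
    rw [← hv, ← LinearMap.comp_apply, ← LinearMap.lTensor_comp, LinearMap.comp_assoc, hr,
      LinearMap.comp_id]
  refine ⟨TensorProduct.map r r w, ?_⟩
  rw [← LinearMap.comp_apply, ← TensorProduct.map_comp]
  conv_rhs => rw [← e₁, ← e₂]
  rw [← LinearMap.comp_apply, LinearMap.rTensor_comp_lTensor]

theorem braiding_inclSq_mem (S : BialgebraData K A) (hS : IsBraidedBialgebra S)
    (z : primitives S ⊗[K] primitives S) :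
    S.braiding (inclSq S z) ∈ LinearMap.range (inclSq S) := by
  induction z using TensorProduct.induction_on with
  | zero => simp
  | add z w hz hw => rw [map_add, map_add]; exact Submodule.add_mem _ hz hw
  | tmul x y =>
    obtain ⟨x, hx⟩ := x
    obtain ⟨y, hy⟩ := y
    rw [mem_primitives] at hx hy
    refine mem_range_of_ker (primitives S)
      (S.comul - ((TensorProduct.mk K A A).flip 1 + TensorProduct.mk K A A 1))
      (LinearMap.eqLocus_eq_ker_sub _ _) _ ?_ ?_
    · have h := LinearMap.congr_fun hS.coalgebra.comul_left (x ⊗ₜ[K] y)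
      have a₁ : ∀ w : A ⊗[K] A, cTwo S.braiding (w ⊗ₜ[K] 1) =
          LinearMap.rTensor A ((TensorProduct.mk K A A).flip 1) w := by
        intro w
        induction w using TensorProduct.induction_on with
        | zero => simp
        | add z w hz hw => rw [TensorProduct.add_tmul, map_add, map_add, hz, hw]
        | tmul a b => simp [cTwo, onLast, hS.algebra.one_right]
      have a₂ : ∀ w : A ⊗[K] A, (TensorProduct.assoc K A A A).symm (1 ⊗ₜ[K] w) =
          LinearMap.rTensor A (TensorProduct.mk K A A 1) w := by
        intro w
        induction w using TensorProduct.induction_on with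
        | zero => simp
        | add z w hz hw => rw [TensorProduct.tmul_add, map_add, map_add, hz, hw]
        | tmul a b => simp
      simp only [LinearMap.comp_apply, LinearMap.lTensor_tmul, hy, TensorProduct.tmul_add,
        map_add, LinearEquiv.coe_coe, TensorProduct.assoc_symm_tmul, cOne, onFirst,
        LinearMap.rTensor_tmul, a₁, hS.algebra.one_right] at h
      simp only [cTwo, onLast, LinearMap.comp_apply, LinearEquiv.coe_coe,
        TensorProduct.assoc_tmul, LinearMap.lTensor_tmul, a₂] at h
      simp only [inclSq, TensorProduct.map_tmul, Submodule.subtype_apply, LinearMap.rTensor_sub,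
        LinearMap.rTensor_add, LinearMap.sub_apply, LinearMap.add_apply, h, sub_self]
    · have h := LinearMap.congr_fun hS.coalgebra.comul_right (x ⊗ₜ[K] y)
      have a₁ : ∀ w : A ⊗[K] A, (TensorProduct.assoc K A A A) (w ⊗ₜ[K] 1) =
          LinearMap.lTensor A ((TensorProduct.mk K A A).flip 1) w := by
        intro w
        induction w using TensorProduct.induction_on with
        | zero => simp
        | add z w hz hw => rw [TensorProduct.add_tmul, map_add, map_add, hz, hw]
        | tmul a b => simp
      have a₂ : ∀ w : A ⊗[K] A, (TensorProduct.assoc K A A A)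
          (cOne S.braiding ((TensorProduct.assoc K A A A).symm (1 ⊗ₜ[K] w))) =
          LinearMap.lTensor A (TensorProduct.mk K A A 1) w := by
        intro w
        induction w using TensorProduct.induction_on with
        | zero => simp
        | add z w hz hw => simp only [TensorProduct.tmul_add, map_add, hz, hw]
        | tmul a b => simp [cOne, onFirst, hS.algebra.one_left]
      have h' := congrArg (TensorProduct.assoc K A A A) h
      simp only [LinearMap.comp_apply, LinearMap.rTensor_tmul, hx, TensorProduct.add_tmul,
        map_add, LinearEquiv.coe_coe, LinearEquiv.apply_symm_apply, cTwo, onLast,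
        TensorProduct.assoc_tmul, LinearMap.lTensor_tmul, hS.algebra.one_left,
        TensorProduct.assoc_symm_tmul, a₂] at h'
      simp only [cOne, onFirst, LinearMap.rTensor_tmul, a₁] at h'
      simp only [inclSq, TensorProduct.map_tmul, Submodule.subtype_apply, LinearMap.lTensor_sub,
        LinearMap.lTensor_add, LinearMap.sub_apply, LinearMap.add_apply, h', sub_self]

/-- The infinitesimal braiding `c_P : P ⊗ P → P ⊗ P`, the restriction of the braiding of `A`
(see `inclSq_primBraiding`). -/
def primBraiding (S : BialgebraData K A) (hS : IsBraidedBialgebra S) :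
    primitives S ⊗[K] primitives S →ₗ[K] primitives S ⊗[K] primitives S :=
  (LinearEquiv.ofInjective (inclSq S) (inclSq_injective S)).symm.toLinearMap ∘ₗ
    LinearMap.codRestrict (LinearMap.range (inclSq S)) (S.braiding ∘ₗ inclSq S)
      (braiding_inclSq_mem S hS)

theorem inclSq_primBraiding (S : BialgebraData K A) (hS : IsBraidedBialgebra S)
    (z : primitives S ⊗[K] primitives S) :
    inclSq S (primBraiding S hS z) = S.braiding (inclSq S z) := by
  have h := LinearEquiv.apply_symm_apply (LinearEquiv.ofInjective (inclSq S) (inclSq_injective S))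
    (LinearMap.codRestrict (LinearMap.range (inclSq S)) (S.braiding ∘ₗ inclSq S)
      (braiding_inclSq_mem S hS) z)
  exact congrArg Subtype.val h

theorem comul_mul_inclSq (S : BialgebraData K A) (hS : IsBraidedBialgebra S)
    (z : primitives S ⊗[K] primitives S) :
    S.comul (LinearMap.mul' K A (inclSq S z)) =
      LinearMap.mul' K A (inclSq S z) ⊗ₜ[K] 1 + inclSq S z + S.braiding (inclSq S z) +
        1 ⊗ₜ[K] LinearMap.mul' K A (inclSq S z) := by
  induction z using TensorProduct.induction_on with
  | zero => simp
  | add z w hz hw =>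
    simp only [map_add, hz, hw, TensorProduct.add_tmul, TensorProduct.tmul_add]
    abel
  | tmul x y =>
    obtain ⟨x, hx⟩ := x
    obtain ⟨y, hy⟩ := y
    rw [mem_primitives] at hx hy
    have a₁ : ∀ w : A ⊗[K] A, TensorProduct.map (LinearMap.mul' K A) (LinearMap.mul' K A)
        ((TensorProduct.assoc K A A (A ⊗[K] A)).symm
          (1 ⊗ₜ[K] (TensorProduct.assoc K A A A) (w ⊗ₜ[K] 1))) = w := by
      intro w
      induction w using TensorProduct.induction_on with
      | zero => simp
      | add z w hz hw => simp only [TensorProduct.add_tmul, map_add, TensorProduct.tmul_add, hz, hw]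
      | tmul a b => simp
    simp only [inclSq, TensorProduct.map_tmul, Submodule.subtype_apply, LinearMap.mul'_apply,
      hS.comul_mul, hx, hy, map_add, LinearMap.add_apply, braidedMul, TensorProduct.curry_apply,
      LinearMap.comp_apply, LinearEquiv.coe_coe, TensorProduct.assoc_tmul, LinearMap.lTensor_tmul,
      TensorProduct.assoc_symm_tmul, LinearMap.rTensor_tmul, hS.algebra.one_left,
      hS.algebra.one_right, one_mul, mul_one, a₁]
    abel

theorem canonicalBracket_mem (S : BialgebraData K A) (hS : IsBraidedBialgebra S) (q : K)
    (hq : IsHecke (primBraiding S hS) q) (z : primitives S ⊗[K] primitives S) :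
    LinearMap.mul' K A (inclSq S (heckeDiff (primBraiding S hS) q z)) ∈ primitives S := by
  have h : primBraiding S hS (heckeDiff (primBraiding S hS) q z) +
      heckeDiff (primBraiding S hS) q z = 0 := LinearMap.congr_fun hq z
  have h' := congrArg (inclSq S) h
  set w := heckeDiff (primBraiding S hS) q z
  rw [map_add, inclSq_primBraiding, map_zero] at h'
  rw [mem_primitives, comul_mul_inclSq S hS, add_assoc (_ ⊗ₜ[K] _), add_comm (inclSq S w), h',
    add_zero]

/-- The canonical bracket `b_P = ∇ (c_P - q Id) : P ⊗ P → P`. -/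
def canonicalBracket (S : BialgebraData K A) (hS : IsBraidedBialgebra S) (q : K)
    (hq : IsHecke (primBraiding S hS) q) :
    primitives S ⊗[K] primitives S →ₗ[K] primitives S :=
  LinearMap.codRestrict (primitives S)
    (LinearMap.mul' K A ∘ₗ inclSq S ∘ₗ heckeDiff (primBraiding S hS) q)
    (canonicalBracket_mem S hS q hq)

end Primitive

/-! ### The tensor algebra and the enveloping algebra of a bracket -/

section Enveloping

variable {K : Type*} [Field K] {V : Type*} [AddCommGroup V] [Module K V]

/-- The operator `t ⊗ v ↦ t · c (v ⊗ w)` on `T(V) ⊗ V`, linear in `w`. -/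
def crossStepRight (c : V ⊗[K] V →ₗ[K] V ⊗[K] V) :
    V →ₗ[K] Module.End K (TensorAlgebra K V ⊗[K] V) :=
  (TensorProduct.curry
    (LinearMap.rTensor V
        (LinearMap.mul' K (TensorAlgebra K V) ∘ₗ
          LinearMap.lTensor (TensorAlgebra K V) (TensorAlgebra.ι K)) ∘ₗ
      (TensorProduct.assoc K (TensorAlgebra K V) V V).symm.toLinearMap ∘ₗ
      LinearMap.lTensor (TensorAlgebra K V) c ∘ₗ
      (TensorProduct.assoc K (TensorAlgebra K V) V V).toLinearMap)).flip

/-- The braiding `c^{1,n}` on `V ⊗ T^n(V)` for all `n`: the map `V ⊗ T(V) → T(V) ⊗ V` that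
moves a vector across a word, one letter of the word after the other, from the left. -/
def crossWord (c : V ⊗[K] V →ₗ[K] V ⊗[K] V) :
    V ⊗[K] TensorAlgebra K V →ₗ[K] TensorAlgebra K V ⊗[K] V :=
  TensorProduct.lift
    (((MulOpposite.opLinearEquiv K).symm.toLinearMap ∘ₗ
        (TensorAlgebra.lift K ((MulOpposite.opLinearEquiv K).toLinearMap ∘ₗ
          crossStepRight c)).toLinearMap).flip ∘ₗ
      TensorProduct.mk K (TensorAlgebra K V) V 1)

/-- The operator `x ⊗ t ↦ c (v ⊗ x) · t` on `T(V) ⊗ T(V)`, linear in `v`. -/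
def crossStepLeft (c : V ⊗[K] V →ₗ[K] V ⊗[K] V) :
    V →ₗ[K] Module.End K (TensorAlgebra K V ⊗[K] TensorAlgebra K V) :=
  TensorProduct.curry
    (LinearMap.lTensor (TensorAlgebra K V)
        (LinearMap.mul' K (TensorAlgebra K V) ∘ₗ
          LinearMap.rTensor (TensorAlgebra K V) (TensorAlgebra.ι K)) ∘ₗ
      (TensorProduct.assoc K (TensorAlgebra K V) V (TensorAlgebra K V)).toLinearMap ∘ₗ
      LinearMap.rTensor (TensorAlgebra K V) (crossWord c) ∘ₗ
      (TensorProduct.assoc K V (TensorAlgebra K V) (TensorAlgebra K V)).symm.toLinearMap)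

/-- The braiding `c_T` of the tensor algebra: it moves a word `v₁ ⋯ vₙ` across another word
letter by letter, the last letter `vₙ` first, every crossing of two letters being `c`. -/
def tensorBraiding (c : V ⊗[K] V →ₗ[K] V ⊗[K] V) :
    TensorAlgebra K V ⊗[K] TensorAlgebra K V →ₗ[K] TensorAlgebra K V ⊗[K] TensorAlgebra K V :=
  TensorProduct.lift
    ((TensorAlgebra.lift K (crossStepLeft c)).toLinearMap.flip ∘ₗ
      (TensorProduct.mk K (TensorAlgebra K V) (TensorAlgebra K V)).flip 1).flip

/-- Right multiplication by `v ⊗ 1 + 1 ⊗ v` in the algebra `T ⊗_{c_T} T`, linear in `v`. -/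
def comulStep (c : V ⊗[K] V →ₗ[K] V ⊗[K] V) :
    V →ₗ[K] Module.End K (TensorAlgebra K V ⊗[K] TensorAlgebra K V) :=
  (braidedMul (tensorBraiding c)).flip ∘ₗ
    ((TensorProduct.mk K (TensorAlgebra K V) (TensorAlgebra K V)).flip 1 +
      TensorProduct.mk K (TensorAlgebra K V) (TensorAlgebra K V) 1) ∘ₗ TensorAlgebra.ι K

/-- The comultiplication `Δ_T` of `T(V, c)`: a word `v₁ ⋯ vₙ` is sent to the product of the
elements `vᵢ ⊗ 1 + 1 ⊗ vᵢ` in `T ⊗_{c_T} T`. -/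
def tensorComul (c : V ⊗[K] V →ₗ[K] V ⊗[K] V) :
    TensorAlgebra K V →ₗ[K] TensorAlgebra K V ⊗[K] TensorAlgebra K V :=
  ((MulOpposite.opLinearEquiv K).symm.toLinearMap ∘ₗ
    (TensorAlgebra.lift K ((MulOpposite.opLinearEquiv K).toLinearMap ∘ₗ
      comulStep c)).toLinearMap).flip (1 ⊗ₜ[K] 1)

/-- The braided bialgebra `T(V, c)`. -/
def tensorData (c : V ⊗[K] V →ₗ[K] V ⊗[K] V) : BialgebraData K (TensorAlgebra K V) where
  braiding := tensorBraiding c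
  comul := tensorComul c
  counit := (TensorAlgebra.lift K (0 : V →ₗ[K] K)).toLinearMap

/-- The set of relations `c z - q z - b z = 0`, `z ∈ V ⊗ V = T²(V)`. -/
inductive EnvelopingRel (c : V ⊗[K] V →ₗ[K] V ⊗[K] V) (b : V ⊗[K] V →ₗ[K] V) (q : K) :
    TensorAlgebra K V → TensorAlgebra K V → Prop
  | of (z : V ⊗[K] V) : EnvelopingRel c b q
      (LinearMap.mul' K (TensorAlgebra K V)
          (TensorProduct.map (TensorAlgebra.ι K) (TensorAlgebra.ι K) (heckeDiff c q z)) -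
        TensorAlgebra.ι K (b z)) 0

/-- The enveloping algebra `U(V, c, b)`: the quotient of `T(V)` by the two-sided ideal
generated by the elements `c z - q z - b z`. -/
abbrev Enveloping (c : V ⊗[K] V →ₗ[K] V ⊗[K] V) (b : V ⊗[K] V →ₗ[K] V) (q : K) : Type _ :=
  RingQuot (EnvelopingRel c b q)

/-- The canonical projection `π : T(V, c) → U(V, c, b)`. -/
def proj (c : V ⊗[K] V →ₗ[K] V ⊗[K] V) (b : V ⊗[K] V →ₗ[K] V) (q : K) :
    TensorAlgebra K V →ₐ[K] Enveloping c b q :=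
  RingQuot.mkAlgHom K (EnvelopingRel c b q)

/-- The canonical map `V → U(V, c, b)`. -/
def envelopingι (c : V ⊗[K] V →ₗ[K] V ⊗[K] V) (b : V ⊗[K] V →ₗ[K] V) (q : K) :
    V →ₗ[K] Enveloping c b q :=
  (proj c b q).toLinearMap ∘ₗ TensorAlgebra.ι K

theorem exists_section (c : V ⊗[K] V →ₗ[K] V ⊗[K] V) (b : V ⊗[K] V →ₗ[K] V) (q : K) :
    ∃ s : Enveloping c b q →ₗ[K] TensorAlgebra K V,
      (proj c b q).toLinearMap ∘ₗ s = LinearMap.id :=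
  (proj c b q).toLinearMap.exists_rightInverse_of_surjective
    (LinearMap.range_eq_top.2 (RingQuot.mkAlgHom_surjective K (EnvelopingRel c b q)))

/-- A choice of representatives in `T(V)` for the elements of `U(V, c, b)`. -/
def representative (c : V ⊗[K] V →ₗ[K] V ⊗[K] V) (b : V ⊗[K] V →ₗ[K] V) (q : K) :
    Enveloping c b q →ₗ[K] TensorAlgebra K V :=
  (exists_section c b q).choose

/-- The structure induced on the quotient `U(V, c, b)` by `T(V, c)`, computed on
representatives: `c_U (π x ⊗ π y) = (π ⊗ π) (c_T (x ⊗ y))`, `Δ_U (π x) = (π ⊗ π) (Δ_T x)`,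
`ε_U (π x) = ε_T x`. That these do not depend on the representatives says precisely that `π`
is a morphism from `tensorData c` to `envelopingData c b q`. -/
def envelopingData (c : V ⊗[K] V →ₗ[K] V ⊗[K] V) (b : V ⊗[K] V →ₗ[K] V) (q : K) :
    BialgebraData K (Enveloping c b q) where
  braiding := TensorProduct.map (proj c b q).toLinearMap (proj c b q).toLinearMap ∘ₗ
    (tensorData c).braiding ∘ₗ
    TensorProduct.map (representative c b q) (representative c b q)
  comul := TensorProduct.map (proj c b q).toLinearMap (proj c b q).toLinearMap ∘ₗ
    (tensorData c).comul ∘ₗ representative c b q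
  counit := (tensorData c).counit ∘ₗ representative c b q

end Enveloping

end Braided

end

noncomputable section

namespace Braided

/-! ### Moving letters across tensors -/

section Moves

variable {K : Type*} [Field K]
variable {X X' Y Z Z' W W' : Type*} [AddCommGroup X] [Module K X] [AddCommGroup X'] [Module K X']
  [AddCommGroup Y] [Module K Y] [AddCommGroup Z] [Module K Z] [AddCommGroup Z'] [Module K Z']
  [AddCommGroup W] [Module K W] [AddCommGroup W'] [Module K W']
variable {A : Type*} [Ring A] [Algebra K A]

/-! Vanishing of the bracket. The canonical bracket `b` is the restriction to `P` of `∇(c_A - q)`,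
hence a `c_P`-bracket, and `bc = -b` because `(c - q)(c + 1) = 0`. Compute `c²b₁` and `c²b₂` once by
the Hecke relation and once by the bracket identities; after cancelling `q - 1` and `q` this leaves
`b₂c₁ + b₂ = b₁c₂ + b₁`. Composing with `c₂` and `c₁` and using the braid equation turns this into
`(1 + q + q²)(b₂c₁ + b₂) = 0`. So `b₂c₁ = -b₂` and `b₁c₂ = -b₁`, and the relations then collapse to
`b₂ = -b₁` (`onLast_eq_neg_onFirst`). Read on vectors, `x ⊗ [y, z] = -[x, y] ⊗ z`; contracting with
functionals forces `b = 0` when `2 ≠ 0` (`eq_zero_of_onLast_eq_neg_onFirst`).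

The structure on `U(V, c, b)`. That `T(V, c)` is a braided bialgebra
(`isBraidedBialgebra_tensorData`) is proved by induction on words. A crossing that is multiplicative
in the word crossed (`IsRightCross`) is determined by its values on letters, so identities for `c`
extend from letters to words; the braid equation is extended one strand at a time. The structure
descends to the quotient because the relators cross words as relators (braid equation and bracket
identities) and are primitive (Hecke condition); the axioms then pass along the surjection `proj`.

The universal property. A braided map `f` from `V` to `P` extends to an algebra map on `T(V)`; it
respects braidings and comultiplications because both sides obey the same recursions on letters. It
kills the relators exactly because `f` is a morphism of brackets into the canonical one, which was
just shown to be zero. -/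

/-- The map `w ↦ f (· ⊗ w)`. -/
def appRight (f : X ⊗[K] W →ₗ[K] W') : W →ₗ[K] X →ₗ[K] W' :=
  (TensorProduct.curry f).flip

@[simp] theorem appRight_apply (f : X ⊗[K] W →ₗ[K] W') (w : W) (x : X) :
    appRight f w x = f (x ⊗ₜ[K] w) := rfl

/-- `x` crosses `z` by means of `k`, and is then combined with `w` by means of `f`. -/
def slide (k : X ⊗[K] Z →ₗ[K] Z' ⊗[K] X') (f : X' ⊗[K] W →ₗ[K] W') :
    X ⊗[K] (Z ⊗[K] W) →ₗ[K] Z' ⊗[K] W' :=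
  LinearMap.lTensor Z' f ∘ₗ (TensorProduct.assoc K Z' X' W).toLinearMap ∘ₗ
    LinearMap.rTensor W k ∘ₗ (TensorProduct.assoc K X Z W).symm.toLinearMap

/-- With `w` frozen as a parameter, only a map on the second leg of the crossing remains. This form
contains no associator, and most computations with `slide` pass through it. -/
theorem slide_tmul (k : X ⊗[K] Z →ₗ[K] Z' ⊗[K] X') (f : X' ⊗[K] W →ₗ[K] W') (x : X) (z : Z)
    (w : W) : slide k f (x ⊗ₜ[K] (z ⊗ₜ[K] w)) =
      LinearMap.lTensor Z' (appRight f w) (k (x ⊗ₜ[K] z)) := by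
  simp only [slide, LinearMap.comp_apply, LinearEquiv.coe_coe, TensorProduct.assoc_symm_tmul,
    LinearMap.rTensor_tmul]
  generalize k (x ⊗ₜ[K] z) = u
  induction u with
  | zero => simp
  | add a b ha hb => simp only [TensorProduct.add_tmul, map_add, ha, hb]
  | tmul a b => simp

/-- Maps applied to the last factor, after the crossing here and before it in `slide_lTensor`, are
absorbed into `f`. Two slides along the same crossing are then compared through their second
arguments alone. -/
theorem lTensor_slide (k : X ⊗[K] Z →ₗ[K] Z' ⊗[K] X') (f : X' ⊗[K] W →ₗ[K] W')
    (g : W' →ₗ[K] Y) (u : X ⊗[K] (Z ⊗[K] W)) :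
    LinearMap.lTensor Z' g (slide k f u) = slide k (g ∘ₗ f) u := by
  simp [slide, LinearMap.lTensor_comp]

theorem slide_lTensor (k : X ⊗[K] Z →ₗ[K] Z' ⊗[K] X') (f : X' ⊗[K] W →ₗ[K] W')
    (g : Y →ₗ[K] W) (x : X) (u : Z ⊗[K] Y) :
    slide k f (x ⊗ₜ[K] LinearMap.lTensor Z g u) =
      slide k (f ∘ₗ LinearMap.lTensor X' g) (x ⊗ₜ[K] u) := by
  induction u with
  | zero => simp
  | add a b ha hb => simp only [TensorProduct.tmul_add, map_add, ha, hb]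
  | tmul a b =>
    rw [LinearMap.lTensor_tmul, slide_tmul, slide_tmul]
    rfl

/-- The crossing of `X ⊗ Y` and `Z`, given crossings of `X` and of `Y` with `Z`. -/
def pairCross (s : X ⊗[K] Z →ₗ[K] Z ⊗[K] X) (s' : Y ⊗[K] Z →ₗ[K] Z ⊗[K] Y) :
    (X ⊗[K] Y) ⊗[K] Z →ₗ[K] Z ⊗[K] (X ⊗[K] Y) :=
  slide s LinearMap.id ∘ₗ LinearMap.lTensor X s' ∘ₗ (TensorProduct.assoc K X Y Z).toLinearMap

@[simp] theorem pairCross_tmul (s : X ⊗[K] Z →ₗ[K] Z ⊗[K] X) (s' : Y ⊗[K] Z →ₗ[K] Z ⊗[K] Y)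
    (x : X) (y : Y) (z : Z) : pairCross s s' ((x ⊗ₜ[K] y) ⊗ₜ[K] z) =
      slide s LinearMap.id (x ⊗ₜ[K] s' (y ⊗ₜ[K] z)) := by
  simp [pairCross]

/-- The `A`-linear extension of `f : X → P` to `A ⊗ X`. -/
def linExt {P : Type*} [AddCommGroup P] [Module K P] [Module A P] [IsScalarTower K A P]
    (f : X →ₗ[K] P) : A ⊗[K] X →ₗ[A] P :=
  TensorProduct.AlgebraTensorModule.lift (LinearMap.toSpanSingleton A (X →ₗ[K] P) f)

@[simp] theorem linExt_tmul {P : Type*} [AddCommGroup P] [Module K P] [Module A P]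
    [IsScalarTower K A P] (f : X →ₗ[K] P) (a : A) (x : X) :
    linExt f (a ⊗ₜ[K] x) = a • f x := by
  simp [linExt]

theorem linExt_add {P : Type*} [AddCommGroup P] [Module K P] [Module A P]
    [IsScalarTower K A P] (f g : X →ₗ[K] P) (u : A ⊗[K] X) :
    linExt (f + g) u = linExt f u + linExt g u := by
  induction u with
  | zero => simp
  | add a b ha hb => rw [map_add, ha, hb, map_add, map_add]; abel
  | tmul a x => simp

theorem linExt_zero {P : Type*} [AddCommGroup P] [Module K P] [Module A P]
    [IsScalarTower K A P] (u : A ⊗[K] X) : linExt (0 : X →ₗ[K] P) u = 0 := by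
  simpa using linExt_add (0 : X →ₗ[K] P) 0 u

/-- The map `a ⊗ x ↦ a · s (x ⊗ z)`. -/
def moveL (s : X ⊗[K] A →ₗ[K] A ⊗[K] X) (z : A) : A ⊗[K] X →ₗ[A] A ⊗[K] X :=
  linExt (appRight s z)

@[simp] theorem moveL_tmul (s : X ⊗[K] A →ₗ[K] A ⊗[K] X) (z a : A) (x : X) :
    moveL s z (a ⊗ₜ[K] x) = a • s (x ⊗ₜ[K] z) := by
  simp [moveL]

/-- `s` is compatible with the algebra structure of its second argument. -/
structure IsRightCross (s : X ⊗[K] A →ₗ[K] A ⊗[K] X) : Prop where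
  one : ∀ x : X, s (x ⊗ₜ[K] 1) = 1 ⊗ₜ[K] x
  mul : ∀ (x : X) (y z : A), s (x ⊗ₜ[K] (y * z)) = moveL s z (s (x ⊗ₜ[K] y))

theorem lTensor_smul (g : X →ₗ[K] Y) (a : A) (u : A ⊗[K] X) :
    LinearMap.lTensor A g (a • u) = a • LinearMap.lTensor A g u := by
  induction u with
  | zero => simp
  | add a b ha hb => simp only [map_add, smul_add, ha, hb]
  | tmul b x => simp [TensorProduct.smul_tmul']

/-- `x · y` for `y` in an algebra, acting on the second factor. -/
def rmul (a : A) : X ⊗[K] A →ₗ[K] X ⊗[K] A := LinearMap.lTensor X (LinearMap.mulRight K a)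

@[simp] theorem rmul_tmul (a b : A) (x : X) : rmul a (x ⊗ₜ[K] b) = x ⊗ₜ[K] (b * a) := by
  simp [rmul]

/-- A tensor crosses a product of two elements one after the other. -/
theorem slide_smul {s : X ⊗[K] A →ₗ[K] A ⊗[K] X} (hs : IsRightCross s)
    (f : X ⊗[K] W →ₗ[K] W') (x : X) (a : A) (u : A ⊗[K] W) :
    slide s f (x ⊗ₜ[K] (a • u)) =
      linExt (slide s f ∘ₗ (TensorProduct.mk K X (A ⊗[K] W)).flip u) (s (x ⊗ₜ[K] a)) := by
  induction u with
  | zero => simp [linExt_zero]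
  | add u v hu hv =>
    rw [smul_add, TensorProduct.tmul_add, map_add, hu, hv, map_add, LinearMap.comp_add,
      linExt_add]
  | tmul b w =>
    rw [TensorProduct.smul_tmul', smul_eq_mul, slide_tmul, hs.mul]
    generalize s (x ⊗ₜ[K] a) = v
    induction v with
    | zero => simp
    | add a b ha hb => simp only [map_add, ha, hb]
    | tmul d x => simp [lTensor_smul, slide_tmul]

/-- Each strand passes a product factor by factor, the inner one first; `slide_smul` then splits the
crossing of the outer strand. With this, `V ⊗ V` can be moved past words as a single strand. -/
theorem IsRightCross.pairCross {s : X ⊗[K] A →ₗ[K] A ⊗[K] X} {s' : Y ⊗[K] A →ₗ[K] A ⊗[K] Y}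
    (hs : IsRightCross s) (hs' : IsRightCross s') : IsRightCross (pairCross s s') where
  one u := by
    induction u with
    | zero => simp
    | add a b ha hb => simp only [TensorProduct.tmul_add, TensorProduct.add_tmul, map_add, ha, hb]
    | tmul x y => simp [hs.one, hs'.one, slide_tmul]
  mul u y z := by
    induction u with
    | zero => simp
    | add a b ha hb => simp only [TensorProduct.add_tmul, map_add, ha, hb]
    | tmul x x' =>
      simp only [pairCross_tmul, hs'.mul]
      generalize s' (x' ⊗ₜ[K] y) = v
      induction v with
      | zero => simp
      | add a b ha hb => simp only [TensorProduct.tmul_add, map_add, ha, hb]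
      | tmul a x' =>
        rw [moveL_tmul, slide_smul hs, slide_tmul]
        generalize s (x ⊗ₜ[K] a) = v
        induction v with
        | zero => simp
        | add a b ha hb => simp only [map_add, ha, hb]
        | tmul a x => simp

end Moves

/-! ### Induction on words -/

section Words

variable {K : Type*} [Field K] {V : Type*} [AddCommGroup V] [Module K V]

/-- Recursions for words peel letters off one fixed side: this version suits `tensorBraiding`, the
next one suits `crossWord`. -/
theorem word_induction_left {C : TensorAlgebra K V → Prop} (hadd : ∀ a b, C a → C b → C (a + b))
    (hsmul : ∀ (r : K) a, C a → C (r • a)) (hone : C 1)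
    (hmul : ∀ v a, C a → C (TensorAlgebra.ι K v * a)) (t : TensorAlgebra K V) : C t := by
  -- Carrying an arbitrary right factor `a` turns the case of a product into a composition of two
  -- implications.
  suffices h : ∀ a, C a → C (t * a) by simpa using h 1 hone
  induction t using TensorAlgebra.induction with
  | algebraMap r => intro a ha; rw [← Algebra.smul_def]; exact hsmul r a ha
  | ι v => exact hmul v
  | mul x y hx hy => intro a ha; rw [mul_assoc]; exact hx _ (hy _ ha)
  | add x y hx hy => intro a ha; rw [add_mul]; exact hadd _ _ (hx _ ha) (hy _ ha)

theorem word_induction_right {C : TensorAlgebra K V → Prop} (hadd : ∀ a b, C a → C b → C (a + b))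
    (hsmul : ∀ (r : K) a, C a → C (r • a)) (hone : C 1)
    (hmul : ∀ v a, C a → C (a * TensorAlgebra.ι K v)) (t : TensorAlgebra K V) : C t := by
  suffices h : ∀ a, C a → C (a * t) by simpa using h 1 hone
  induction t using TensorAlgebra.induction with
  | algebraMap r =>
    intro a ha; rw [← Algebra.commutes, ← Algebra.smul_def]; exact hsmul r a ha
  | ι v => exact hmul v
  | mul x y hx hy => intro a ha; rw [← mul_assoc]; exact hy _ (hx _ ha)
  | add x y hx hy => intro a ha; rw [mul_add]; exact hadd _ _ (hx _ ha) (hy _ ha)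

variable {X Y : Type*} [AddCommGroup X] [Module K X] [AddCommGroup Y] [Module K Y]

/-- A linear map that commutes with crossings of letters commutes with crossings of words. -/
theorem IsRightCross.natural {s : X ⊗[K] TensorAlgebra K V →ₗ[K] TensorAlgebra K V ⊗[K] X}
    {s' : Y ⊗[K] TensorAlgebra K V →ₗ[K] TensorAlgebra K V ⊗[K] Y}
    (hs : IsRightCross s) (hs' : IsRightCross s') (φ : X →ₗ[K] Y)
    (h : ∀ x v, s' (φ x ⊗ₜ[K] TensorAlgebra.ι K v) =
      LinearMap.lTensor (TensorAlgebra K V) φ (s (x ⊗ₜ[K] TensorAlgebra.ι K v)))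
    (x : X) (z : TensorAlgebra K V) :
    s' (φ x ⊗ₜ[K] z) = LinearMap.lTensor (TensorAlgebra K V) φ (s (x ⊗ₜ[K] z)) := by
  induction z using word_induction_right with
  | hadd a b ha hb => simp only [TensorProduct.tmul_add, map_add, ha, hb]
  | hsmul r a ha => simp only [TensorProduct.tmul_smul, map_smul, ha]
  | hone => simp [hs.one, hs'.one]
  | hmul v a ha =>
    rw [hs.mul, hs'.mul, ha]
    generalize s (x ⊗ₜ[K] a) = u
    induction u with
    | zero => simp
    | add a b ha hb => simp only [map_add, ha, hb]
    | tmul a x => simp [lTensor_smul, h]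

end Words

/-! ### The braiding of the tensor algebra -/

section TensorBraiding

open TensorAlgebra (ι)

variable {K : Type*} [Field K] {V : Type*} [AddCommGroup V] [Module K V]
variable (c : V ⊗[K] V →ₗ[K] V ⊗[K] V)

theorem crossStepRight_tmul (w v : V) (t : TensorAlgebra K V) :
    crossStepRight c w (t ⊗ₜ[K] v) = t • LinearMap.rTensor V (ι K) (c (v ⊗ₜ[K] w)) := by
  simp only [crossStepRight, LinearMap.flip_apply, TensorProduct.curry_apply,
    LinearMap.comp_apply, LinearEquiv.coe_coe, TensorProduct.assoc_tmul, LinearMap.lTensor_tmul]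
  generalize c (v ⊗ₜ[K] w) = u
  induction u with
  | zero => simp
  | add a b ha hb => simp only [TensorProduct.tmul_add, map_add, smul_add, ha, hb]
  | tmul a b => simp [TensorProduct.smul_tmul']

theorem crossWord_one (v : V) : crossWord c (v ⊗ₜ[K] 1) = 1 ⊗ₜ[K] v := by
  simp [crossWord]

/-- The lift goes into the opposite of the endomorphism algebra, so the operator of the last letter
is the last one applied. -/
theorem crossWord_mul_ι (v w : V) (t : TensorAlgebra K V) :
    crossWord c (v ⊗ₜ[K] (t * ι K w)) = crossStepRight c w (crossWord c (v ⊗ₜ[K] t)) := by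
  simp [crossWord]

theorem crossWord_ι (v w : V) :
    crossWord c (v ⊗ₜ[K] ι K w) = LinearMap.rTensor V (ι K) (c (v ⊗ₜ[K] w)) := by
  rw [← one_mul (ι K w), crossWord_mul_ι, crossWord_one, crossStepRight_tmul, one_smul]

theorem isRightCross_crossWord : IsRightCross (crossWord c) where
  one := crossWord_one c
  mul v y z := by
    induction z using word_induction_right with
    | hadd a b ha hb =>
      have h : ∀ u, moveL (crossWord c) (a + b) u =
          moveL (crossWord c) a u + moveL (crossWord c) b u := by
        intro u; simp only [moveL, map_add, linExt_add]
      rw [mul_add, TensorProduct.tmul_add, map_add, ha, hb, h]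
    | hsmul r a ha =>
      rw [mul_smul_comm, TensorProduct.tmul_smul, map_smul, ha]
      generalize crossWord c (v ⊗ₜ[K] y) = u
      induction u with
      | zero => simp
      | add a b ha hb => simp only [map_add, smul_add, ha, hb]
      | tmul d x =>
        rw [moveL_tmul, moveL_tmul, TensorProduct.tmul_smul, map_smul, smul_comm]
    | hone =>
      rw [mul_one]
      generalize crossWord c (v ⊗ₜ[K] y) = u
      induction u with
      | zero => simp
      | add a b ha hb => simp only [map_add]; rw [← ha, ← hb]
      | tmul a b => simp [crossWord_one, TensorProduct.smul_tmul']
    | hmul w a ha =>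
      rw [← mul_assoc, crossWord_mul_ι, ha]
      generalize crossWord c (v ⊗ₜ[K] y) = u
      induction u with
      | zero => simp
      | add a b ha hb => simp only [map_add, ha, hb]
      | tmul b x =>
        rw [moveL_tmul, moveL_tmul, crossWord_mul_ι]
        generalize crossWord c (x ⊗ₜ[K] a) = u
        induction u with
        | zero => simp
        | add a b ha hb => simp only [map_add, smul_add, ha, hb]
        | tmul d x => simp [TensorProduct.smul_tmul', crossStepRight_tmul, mul_smul]

/-- Left multiplication by letters. -/
def letterMul : V ⊗[K] TensorAlgebra K V →ₗ[K] TensorAlgebra K V :=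
  LinearMap.mul' K (TensorAlgebra K V) ∘ₗ LinearMap.rTensor (TensorAlgebra K V) (ι K)

@[simp] theorem letterMul_tmul (v : V) (t : TensorAlgebra K V) :
    letterMul (v ⊗ₜ[K] t) = ι K v * t := by
  simp [letterMul]

theorem tensorBraiding_one_left (t : TensorAlgebra K V) :
    tensorBraiding c (1 ⊗ₜ[K] t) = t ⊗ₜ[K] 1 := by
  simp [tensorBraiding]

theorem tensorBraiding_ι_mul (v : V) (x t : TensorAlgebra K V) :
    tensorBraiding c ((ι K v * x) ⊗ₜ[K] t) =
      slide (crossWord c) letterMul (v ⊗ₜ[K] tensorBraiding c (x ⊗ₜ[K] t)) := by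
  simp only [tensorBraiding, TensorProduct.lift.tmul, LinearMap.flip_apply, LinearMap.comp_apply,
    AlgHom.toLinearMap_apply, map_mul, TensorAlgebra.lift_ι_apply, Module.End.mul_apply]
  rfl

theorem tensorBraiding_ι (v : V) (t : TensorAlgebra K V) :
    tensorBraiding c (ι K v ⊗ₜ[K] t) =
      LinearMap.lTensor (TensorAlgebra K V) (ι K) (crossWord c (v ⊗ₜ[K] t)) := by
  rw [← mul_one (ι K v), tensorBraiding_ι_mul, tensorBraiding_one_left, slide_tmul]
  congr 2
  ext; simp

/-- The letters of `x` cross one at a time, whatever stands behind them; after peeling the first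
letter of `x`, only associativity of concatenation is left. -/
theorem tensorBraiding_mul_left (x y t : TensorAlgebra K V) :
    tensorBraiding c ((x * y) ⊗ₜ[K] t) = slide (tensorBraiding c)
      (LinearMap.mul' K (TensorAlgebra K V)) (x ⊗ₜ[K] tensorBraiding c (y ⊗ₜ[K] t)) := by
  induction x using word_induction_left with
  | hadd a b ha hb => simp only [add_mul, TensorProduct.add_tmul, map_add, ha, hb]
  | hsmul r a ha => simp only [smul_mul_assoc, ← TensorProduct.smul_tmul', map_smul, ha]
  | hone =>
    rw [one_mul]
    generalize tensorBraiding c (y ⊗ₜ[K] t) = u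
    induction u with
    | zero => simp
    | add a b ha hb => simp only [TensorProduct.tmul_add, map_add]; rw [← ha, ← hb]
    | tmul a b => simp [slide_tmul, tensorBraiding_one_left]
  | hmul v x hx =>
    rw [mul_assoc, tensorBraiding_ι_mul, hx]
    generalize tensorBraiding c (y ⊗ₜ[K] t) = u
    induction u with
    | zero => simp
    | add a b ha hb => simp only [TensorProduct.tmul_add, map_add, ha, hb]
    | tmul a b =>
      rw [slide_tmul, slide_tmul, tensorBraiding_ι_mul]
      generalize tensorBraiding c (x ⊗ₜ[K] a) = u
      induction u with
      | zero => simp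
      | add a b ha hb => simp only [TensorProduct.tmul_add, map_add, ha, hb]
      | tmul d e =>
        rw [LinearMap.lTensor_tmul, slide_tmul, slide_tmul]
        generalize crossWord c (v ⊗ₜ[K] d) = u
        induction u with
        | zero => simp
        | add a b ha hb => simp only [map_add, ha, hb]
        | tmul d e => simp [mul_assoc]

/-- Multiplicativity in the crossed word is inherited from a single letter: each letter of `x` in
turn passes `y` and then `z`, by `slide_smul`. -/
theorem isRightCross_tensorBraiding : IsRightCross (tensorBraiding c) where
  one x := by
    induction x using word_induction_left with
    | hadd a b ha hb => simp only [TensorProduct.tmul_add, TensorProduct.add_tmul, map_add, ha, hb]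
    | hsmul r a ha => rw [← TensorProduct.smul_tmul', map_smul, ha, TensorProduct.tmul_smul]
    | hone => exact tensorBraiding_one_left c 1
    | hmul v x hx => simp [tensorBraiding_ι_mul, hx, slide_tmul, crossWord_one]
  mul x y z := by
    induction x using word_induction_left with
    | hadd a b ha hb => simp only [TensorProduct.add_tmul, map_add, ha, hb]
    | hsmul r a ha =>
      simp only [← TensorProduct.smul_tmul', map_smul, ha]
      generalize tensorBraiding c (a ⊗ₜ[K] y) = u
      induction u with
      | zero => simp
      | add a b ha hb => simp only [map_add, smul_add, ha, hb]
      | tmul a b =>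
        rw [moveL_tmul, TensorProduct.smul_tmul', moveL_tmul, smul_assoc]
    | hone =>
      simp [tensorBraiding_one_left, TensorProduct.smul_tmul']
    | hmul v x hx =>
      rw [tensorBraiding_ι_mul, tensorBraiding_ι_mul, hx]
      generalize tensorBraiding c (x ⊗ₜ[K] y) = u
      induction u with
      | zero => simp
      | add a b ha hb => simp only [TensorProduct.tmul_add, map_add, ha, hb]
      | tmul a x =>
        rw [moveL_tmul, slide_smul (isRightCross_crossWord c), slide_tmul]
        generalize crossWord c (v ⊗ₜ[K] a) = u
        induction u with
        | zero => simp
        | add a b ha hb => simp only [map_add, ha, hb]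
        | tmul d w => simp [tensorBraiding_ι_mul]

end TensorBraiding

/-! ### The braid equation on the tensor algebra -/

/-- Up to the associator, `c₁c₂` is the crossing of the pair `V ⊗ V` with `V`. The braid equation
thus says that this crossing is natural with respect to `c`, a form to which `IsRightCross.natural`
applies. -/
theorem isBraiding_iff {K : Type*} [Field K] {V : Type*} [AddCommGroup V] [Module K V]
    (c : V ⊗[K] V →ₗ[K] V ⊗[K] V) :
    IsBraiding c ↔ ∀ z w, pairCross c c (c z ⊗ₜ[K] w) =
      LinearMap.lTensor V c (pairCross c c (z ⊗ₜ[K] w)) := by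
  have h₁ : ∀ u, pairCross c c u = TensorProduct.assoc K V V V (cOne c (cTwo c u)) := by
    intro u; simp [pairCross, slide, cOne, cTwo, onFirst, onLast]
  have h₂ : ∀ u, LinearMap.lTensor V c (TensorProduct.assoc K V V V u) =
      TensorProduct.assoc K V V V (cTwo c u) := by
    intro u; simp [cTwo, onLast]
  constructor
  · intro h z w
    have := LinearMap.congr_fun h (z ⊗ₜ[K] w)
    rw [h₁, h₁, h₂]
    exact congrArg _ this.symm |>.symm
  · intro h
    refine TensorProduct.ext' fun z w => ?_
    have := h z w
    rw [h₁, h₁, h₂] at this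
    exact (TensorProduct.assoc K V V V).injective this

section TensorBraid

open TensorAlgebra (ι)

variable {K : Type*} [Field K] {V : Type*} [AddCommGroup V] [Module K V]
variable {c : V ⊗[K] V →ₗ[K] V ⊗[K] V}

theorem pairCross_crossWord_ι (c : V ⊗[K] V →ₗ[K] V ⊗[K] V) (z : V ⊗[K] V) (w : V) :
    pairCross (crossWord c) (crossWord c) (z ⊗ₜ[K] ι K w) =
      LinearMap.rTensor (V ⊗[K] V) (ι K) (pairCross c c (z ⊗ₜ[K] w)) := by
  induction z with
  | zero => simp
  | add a b ha hb => simp only [TensorProduct.add_tmul, map_add, ha, hb]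
  | tmul v u =>
    rw [pairCross_tmul, pairCross_tmul, crossWord_ι]
    generalize c (u ⊗ₜ[K] w) = p
    induction p with
    | zero => simp
    | add a b ha hb => simp only [TensorProduct.tmul_add, map_add, ha, hb]
    | tmul w u =>
      rw [LinearMap.rTensor_tmul, slide_tmul, slide_tmul, crossWord_ι]
      generalize c (v ⊗ₜ[K] w) = p
      induction p with
      | zero => simp
      | add a b ha hb => simp only [map_add, ha, hb]
      | tmul w u => simp

/-- The crossing of a pair of letters with words is multiplicative, so its naturality with respect
to `c` need only be tested on one letter, where it is the braid equation. -/
theorem braid_letter_letter_word (hc : IsBraiding c) (z : V ⊗[K] V) (t : TensorAlgebra K V) :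
    pairCross (crossWord c) (crossWord c) (c z ⊗ₜ[K] t) =
      LinearMap.lTensor (TensorAlgebra K V) c
        (pairCross (crossWord c) (crossWord c) (z ⊗ₜ[K] t)) := by
  have hk := (isRightCross_crossWord c).pairCross (isRightCross_crossWord c)
  refine hk.natural hk c (fun x v => ?_) z t
  rw [pairCross_crossWord_ι, pairCross_crossWord_ι, (isBraiding_iff c).1 hc]
  exact LinearMap.congr_fun ((LinearMap.rTensor_comp_lTensor _ _ _).trans
    (LinearMap.lTensor_comp_rTensor _ _ _).symm) _

variable {X : Type*} [AddCommGroup X] [Module K X]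

variable (K V X) in
/-- The action of letters on `T(V) ⊗ X` by left multiplication. -/
def letterSMul : V ⊗[K] (TensorAlgebra K V ⊗[K] X) →ₗ[K] TensorAlgebra K V ⊗[K] X :=
  LinearMap.rTensor X letterMul ∘ₗ
    (TensorProduct.assoc K V (TensorAlgebra K V) X).symm.toLinearMap

@[simp] theorem letterSMul_tmul (v : V) (u : TensorAlgebra K V ⊗[K] X) :
    letterSMul K V X (v ⊗ₜ[K] u) = ι K v • u := by
  induction u with
  | zero => simp
  | add a b ha hb => simp only [TensorProduct.tmul_add, map_add, smul_add, ha, hb]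
  | tmul a b => simp [letterSMul, TensorProduct.smul_tmul']

theorem pairCross_smul (v : V) (s : X ⊗[K] TensorAlgebra K V →ₗ[K] TensorAlgebra K V ⊗[K] X)
    (w : TensorAlgebra K V ⊗[K] X) (z : TensorAlgebra K V) :
    pairCross (tensorBraiding c) s ((ι K v • w) ⊗ₜ[K] z) =
      slide (crossWord c) (letterSMul K V X)
        (v ⊗ₜ[K] pairCross (tensorBraiding c) s (w ⊗ₜ[K] z)) := by
  induction w with
  | zero => simp
  | add a b ha hb =>
    simp only [TensorProduct.add_tmul, TensorProduct.tmul_add, smul_add, map_add, ha, hb]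
  | tmul y x =>
    rw [TensorProduct.smul_tmul', smul_eq_mul, pairCross_tmul, pairCross_tmul]
    generalize s (x ⊗ₜ[K] z) = p
    induction p with
    | zero => simp
    | add a b ha hb => simp only [TensorProduct.tmul_add, map_add, ha, hb]
    | tmul z x =>
      rw [slide_tmul, slide_tmul, tensorBraiding_ι_mul, lTensor_slide, slide_lTensor]
      congr 1
      congr 1
      refine TensorProduct.ext' fun u y => ?_
      simp [TensorProduct.smul_tmul']

/-- The hypothesis `h` says that `f`, too, consumes a word letter by letter, through `g`. For `f =
tensorBraiding c` and `g = slide (crossWord c) letterMul`, this is the inductive step for a word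
that crosses two words in succession. -/
theorem slide_ι_mul {P : Type*} [AddCommGroup P] [Module K P] (v : V)
    (x : TensorAlgebra K V) (f : TensorAlgebra K V ⊗[K] X →ₗ[K] P)
    (g : V ⊗[K] P →ₗ[K] P)
    (h : ∀ v x y, f ((ι K v * x) ⊗ₜ[K] y) = g (v ⊗ₜ[K] f (x ⊗ₜ[K] y)))
    (w : TensorAlgebra K V ⊗[K] X) :
    slide (tensorBraiding c) f ((ι K v * x) ⊗ₜ[K] w) =
      slide (crossWord c) g (v ⊗ₜ[K] slide (tensorBraiding c) f (x ⊗ₜ[K] w)) := by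
  induction w with
  | zero => simp
  | add a b ha hb => simp only [TensorProduct.tmul_add, map_add, ha, hb]
  | tmul z y =>
    rw [slide_tmul, slide_tmul, tensorBraiding_ι_mul, lTensor_slide, slide_lTensor]
    congr 1
    congr 1
    refine TensorProduct.ext' fun v x => ?_
    simp [h]

theorem crossWord_ι_mul (v u : V) (y : TensorAlgebra K V) :
    crossWord c (v ⊗ₜ[K] (ι K u * y)) =
      moveL (crossWord c) y (LinearMap.rTensor V (ι K) (c (v ⊗ₜ[K] u))) := by
  rw [(isRightCross_crossWord c).mul, crossWord_ι]

/-- On `z ⊗ y`, the letter `v` crosses `z`, then `u`, then `y`. By the braid equation for two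
letters and a word, `v` and `u` may exchange places before either of them crosses `z`. -/
theorem slide_slide_letterMul (hc : IsBraiding c) (v u : V)
    (w : TensorAlgebra K V ⊗[K] TensorAlgebra K V) :
    slide (crossWord c) (crossWord c)
        (v ⊗ₜ[K] slide (crossWord c) letterMul (u ⊗ₜ[K] w)) =
      slide (crossWord c) (letterSMul K V V)
        (LinearMap.lTensor V (appRight (slide (crossWord c) (crossWord c)) w)
          (c (v ⊗ₜ[K] u))) := by
  induction w with
  | zero => simp
  | add a b ha hb => simp only [TensorProduct.tmul_add, map_add, ha, hb, LinearMap.lTensor_add,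
      LinearMap.add_apply]
  | tmul z y =>
    -- `Θ` completes the crossing of `v` with `u y` once `v` and `u` are exchanged: `crossWord c (v
    -- ⊗ ι u * y) = Θ (c (v ⊗ u))`.
    set Θ : V ⊗[K] V →ₗ[K] TensorAlgebra K V ⊗[K] V :=
      (moveL (crossWord c) y).restrictScalars K ∘ₗ LinearMap.rTensor V (ι K) with hΘ
    have h : ∀ p : TensorAlgebra K V ⊗[K] V, slide (crossWord c) (crossWord c)
        (v ⊗ₜ[K] LinearMap.lTensor _ (appRight letterMul y) p) =
        LinearMap.lTensor _ Θ (LinearMap.lTensor _ c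
          (slide (crossWord c) LinearMap.id (v ⊗ₜ[K] p))) := by
      intro p
      rw [slide_lTensor, lTensor_slide, lTensor_slide]
      congr 1
      congr 1
      refine TensorProduct.ext' fun v u => ?_
      simp [crossWord_ι_mul, hΘ]
    rw [slide_tmul, h, ← pairCross_tmul, ← braid_letter_letter_word hc]
    generalize c (v ⊗ₜ[K] u) = p
    induction p with
    | zero => simp
    | add a b ha hb => simp only [TensorProduct.add_tmul, map_add, ha, hb]
    | tmul u v =>
      rw [pairCross_tmul, lTensor_slide, LinearMap.lTensor_tmul, appRight_apply, slide_tmul,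
        slide_lTensor]
      congr 1
      congr 1
      refine TensorProduct.ext' fun v u => ?_
      simp [hΘ]

/-- Induction on the middle word: its first letter is exchanged with `v` by `slide_slide_letterMul`,
and the rest is the induction hypothesis. The exchange replaces `v`, hence the generalization over
it. -/
theorem braid_letter_word_word (hc : IsBraiding c) (v : V) (y z : TensorAlgebra K V) :
    pairCross (tensorBraiding c) (crossWord c) (crossWord c (v ⊗ₜ[K] y) ⊗ₜ[K] z) =
      slide (crossWord c) (crossWord c) (v ⊗ₜ[K] tensorBraiding c (y ⊗ₜ[K] z)) := by
  induction y using word_induction_left generalizing v z with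
  | hadd a b ha hb =>
    simp only [TensorProduct.tmul_add, TensorProduct.add_tmul, map_add, ha, hb]
  | hsmul r a ha =>
    simp only [← TensorProduct.smul_tmul', TensorProduct.tmul_smul, map_smul, ha]
  | hone =>
    rw [tensorBraiding_one_left, slide_tmul, crossWord_one, pairCross_tmul]
    generalize crossWord c (v ⊗ₜ[K] z) = p
    induction p with
    | zero => simp
    | add a b ha hb => simp only [TensorProduct.tmul_add, map_add, ha, hb]
    | tmul a b => simp [slide_tmul, tensorBraiding_one_left, crossWord_one]
  | hmul u y hy =>
    rw [tensorBraiding_ι_mul, slide_slide_letterMul hc, crossWord_ι_mul]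
    generalize c (v ⊗ₜ[K] u) = p
    induction p with
    | zero => simp
    | add a b ha hb => simp only [TensorProduct.add_tmul, map_add, ha, hb]
    | tmul u v =>
      rw [LinearMap.lTensor_tmul, appRight_apply, ← hy, LinearMap.rTensor_tmul, moveL_tmul]
      exact pairCross_smul _ _ _ _

/-- The letter `v` may cross `y` before or after both words have been moved past `z`: this is
`braid_letter_word_word`, carried along with a bystander `x` to which `v` is finally attached. -/
theorem pairCross_slide_letterMul (hc : IsBraiding c) (v : V)
    (w : TensorAlgebra K V ⊗[K] TensorAlgebra K V) (z : TensorAlgebra K V) :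
    pairCross (tensorBraiding c) (tensorBraiding c)
        (slide (crossWord c) letterMul (v ⊗ₜ[K] w) ⊗ₜ[K] z) =
      slide (crossWord c) (slide (crossWord c) letterMul)
        (v ⊗ₜ[K] pairCross (tensorBraiding c) (tensorBraiding c) (w ⊗ₜ[K] z)) := by
  induction w with
  | zero => simp
  | add a b ha hb => simp only [TensorProduct.tmul_add, TensorProduct.add_tmul, map_add, ha, hb]
  | tmul y x =>
    have h : ∀ p : TensorAlgebra K V ⊗[K] V, pairCross (tensorBraiding c) (tensorBraiding c)
        (LinearMap.lTensor _ (appRight letterMul x) p ⊗ₜ[K] z) =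
        slide (pairCross (tensorBraiding c) (crossWord c))
          (LinearMap.lTensor _ letterMul ∘ₗ
            (TensorProduct.assoc K (TensorAlgebra K V) V (TensorAlgebra K V)).toLinearMap)
          (p ⊗ₜ[K] tensorBraiding c (x ⊗ₜ[K] z)) := by
      intro p
      induction p with
      | zero => simp
      | add a b ha hb => simp only [TensorProduct.add_tmul, map_add, ha, hb]
      | tmul y v =>
        rw [LinearMap.lTensor_tmul, appRight_apply, letterMul_tmul, pairCross_tmul,
          tensorBraiding_ι_mul]
        generalize tensorBraiding c (x ⊗ₜ[K] z) = p
        induction p with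
        | zero => simp
        | add a b ha hb => simp only [TensorProduct.tmul_add, map_add, ha, hb]
        | tmul z x =>
          rw [slide_tmul, slide_tmul, pairCross_tmul, slide_lTensor, lTensor_slide]
          congr 1
          congr 1
          refine TensorProduct.ext' fun y v => ?_
          simp
    rw [slide_tmul, h, pairCross_tmul]
    generalize tensorBraiding c (x ⊗ₜ[K] z) = p
    induction p with
    | zero => simp
    | add a b ha hb => simp only [TensorProduct.tmul_add, map_add, ha, hb]
    | tmul z x =>
      rw [slide_tmul, slide_tmul, braid_letter_word_word hc, lTensor_slide,
        slide_lTensor]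
      congr 1
      congr 1
      refine TensorProduct.ext' fun v y => ?_
      simp only [LinearMap.comp_apply, LinearMap.lTensor_tmul, appRight_apply, LinearMap.id_apply,
        slide_tmul]
      generalize crossWord c (v ⊗ₜ[K] y) = p
      induction p with
      | zero => simp
      | add a b ha hb => simp only [TensorProduct.add_tmul, map_add, ha, hb]
      | tmul a b => simp

/-- Induction on the first word; on both sides a new first letter crosses what the remaining letters
have already crossed. -/
theorem braid_word_word_word (hc : IsBraiding c) (x y z : TensorAlgebra K V) :
    pairCross (tensorBraiding c) (tensorBraiding c) (tensorBraiding c (x ⊗ₜ[K] y) ⊗ₜ[K] z) =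
      slide (tensorBraiding c) (tensorBraiding c)
        (x ⊗ₜ[K] tensorBraiding c (y ⊗ₜ[K] z)) := by
  induction x using word_induction_left with
  | hadd a b ha hb => simp only [TensorProduct.add_tmul, map_add, ha, hb]
  | hsmul r a ha => simp only [← TensorProduct.smul_tmul', map_smul, ha]
  | hone =>
    rw [tensorBraiding_one_left, pairCross_tmul, tensorBraiding_one_left, slide_tmul]
    generalize tensorBraiding c (y ⊗ₜ[K] z) = p
    induction p with
    | zero => simp
    | add a b ha hb => simp only [TensorProduct.tmul_add, map_add, ← ha, ← hb]
    | tmul a b => simp [slide_tmul, tensorBraiding_one_left]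
  | hmul v x hx =>
    rw [tensorBraiding_ι_mul, pairCross_slide_letterMul hc, hx]
    exact (slide_ι_mul v x _ _ (tensorBraiding_ι_mul c) _).symm

theorem isBraiding_tensorBraiding (hc : IsBraiding c) : IsBraiding (tensorBraiding c) := by
  rw [isBraiding_iff]
  intro w z
  induction w with
  | zero => simp
  | add a b ha hb => simp only [TensorProduct.add_tmul, map_add, ha, hb]
  | tmul x y =>
    rw [braid_word_word_word hc, pairCross_tmul, lTensor_slide, LinearMap.comp_id]

end TensorBraid

/-! ### Braided algebras and the product of `A ⊗_c A` -/

section BraidedAlgebras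

variable {K : Type*} [Field K] {A : Type*} [Ring A] [Algebra K A]
variable {c : A ⊗[K] A →ₗ[K] A ⊗[K] A}

theorem commutesWith_mul_iff (c : A ⊗[K] A →ₗ[K] A ⊗[K] A) :
    CommutesWith c (LinearMap.mul' K A) ↔
      (∀ x y z, c ((x * y) ⊗ₜ[K] z) = slide c (LinearMap.mul' K A) (x ⊗ₜ[K] c (y ⊗ₜ[K] z))) ∧
      ∀ x y z, c (x ⊗ₜ[K] (y * z)) = moveL c z (c (x ⊗ₜ[K] y)) := by
  have h₁ : ∀ x y z, onLast (LinearMap.mul' K A) (cOne c (cTwo c ((x ⊗ₜ[K] y) ⊗ₜ[K] z))) =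
      slide c (LinearMap.mul' K A) (x ⊗ₜ[K] c (y ⊗ₜ[K] z)) := by
    intro x y z; simp [onLast, cOne, cTwo, onFirst, slide]
  have h₂ : ∀ x y z, onFirst (LinearMap.mul' K A) (cTwo c (cOne c ((x ⊗ₜ[K] y) ⊗ₜ[K] z))) =
      moveL c z (c (x ⊗ₜ[K] y)) := by
    intro x y z
    simp only [cOne, onFirst, LinearMap.rTensor_tmul]
    generalize c (x ⊗ₜ[K] y) = u
    induction u with
    | zero => simp
    | add a b ha hb => simp only [TensorProduct.add_tmul, map_add, ha, hb]
    | tmul a b =>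
      simp only [cTwo, onLast, LinearMap.comp_apply, LinearEquiv.coe_coe,
        TensorProduct.assoc_tmul, LinearMap.lTensor_tmul, moveL_tmul]
      generalize c (b ⊗ₜ[K] z) = u
      induction u with
      | zero => simp
      | add a b ha hb => simp only [TensorProduct.tmul_add, smul_add, map_add, ha, hb]
      | tmul d e => simp [TensorProduct.smul_tmul']
  constructor
  · rintro ⟨h, h'⟩
    refine ⟨fun x y z => ?_, fun x y z => ?_⟩
    · rw [← h₁]; exact LinearMap.congr_fun h ((x ⊗ₜ[K] y) ⊗ₜ[K] z)
    · rw [← h₂]; exact LinearMap.congr_fun h' ((x ⊗ₜ[K] y) ⊗ₜ[K] z)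
  · rintro ⟨h, h'⟩
    refine ⟨TensorProduct.ext_threefold fun x y z => ?_,
      TensorProduct.ext_threefold fun x y z => ?_⟩
    · exact (h x y z).trans (h₁ x y z).symm
    · exact (h' x y z).trans (h₂ x y z).symm

theorem IsBraidedAlgebra.isRightCross (hc : IsBraidedAlgebra c) : IsRightCross c :=
  ⟨hc.one_right, ((commutesWith_mul_iff c).1 hc.mul).2⟩

theorem IsBraidedAlgebra.mul_left (hc : IsBraidedAlgebra c) (x y z : A) :
    c ((x * y) ⊗ₜ[K] z) = slide c (LinearMap.mul' K A) (x ⊗ₜ[K] c (y ⊗ₜ[K] z)) :=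
  ((commutesWith_mul_iff c).1 hc.mul).1 x y z

theorem braidedMul_tmul (c : A ⊗[K] A →ₗ[K] A ⊗[K] A) (x y z w : A) :
    braidedMul c (x ⊗ₜ[K] y) (z ⊗ₜ[K] w) = x • rmul w (c (y ⊗ₜ[K] z)) := by
  simp only [braidedMul, TensorProduct.curry_apply,
    LinearMap.comp_apply, LinearEquiv.coe_coe, TensorProduct.assoc_tmul, LinearMap.lTensor_tmul,
    TensorProduct.assoc_symm_tmul, LinearMap.rTensor_tmul]
  generalize c (y ⊗ₜ[K] z) = u
  induction u with
  | zero => simp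
  | add a b ha hb =>
    simp only [TensorProduct.tmul_add, TensorProduct.add_tmul, smul_add, map_add, ha, hb]
  | tmul a b => simp [TensorProduct.smul_tmul']

theorem rmul_smul (a b : A) (u : A ⊗[K] A) : rmul a (b • u) = b • rmul a u :=
  lTensor_smul _ _ _

theorem braidedMul_smul (a : A) (u v : A ⊗[K] A) :
    braidedMul c (a • u) v = a • braidedMul c u v := by
  induction u with
  | zero => simp
  | add x y hx hy => simp only [smul_add, map_add, LinearMap.add_apply, hx, hy]
  | tmul x y =>
    induction v with
    | zero => simp
    | add x y hx hy => simp only [smul_add, map_add, hx, hy]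
    | tmul z w => rw [TensorProduct.smul_tmul', smul_eq_mul, braidedMul_tmul, braidedMul_tmul,
        mul_smul]

theorem rmul_rmul (a b : A) (u : A ⊗[K] A) : rmul a (rmul b u) = rmul (b * a) u := by
  induction u with
  | zero => simp
  | add x y hx hy => simp only [map_add, hx, hy]
  | tmul x y => simp [mul_assoc]

/-- In crossing `p`, the factor `w` of the product `y w` goes first; what remains of the operation
is a product in `A ⊗_c A`. -/
theorem moveL_rmul (hm : ∀ x y z, c ((x * y) ⊗ₜ[K] z) =
      slide c (LinearMap.mul' K A) (x ⊗ₜ[K] c (y ⊗ₜ[K] z))) (w p : A) (u : A ⊗[K] A) :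
    moveL c p (rmul w u) =
      braidedMul c u (c (w ⊗ₜ[K] p)) := by
  induction u with
  | zero => simp
  | add x y hx hy => simp only [map_add, LinearMap.add_apply, hx, hy]
  | tmul x y =>
    rw [rmul_tmul, moveL_tmul, hm]
    generalize c (w ⊗ₜ[K] p) = u
    induction u with
    | zero => simp
    | add a b ha hb => simp only [TensorProduct.tmul_add, smul_add, map_add, ha, hb]
    | tmul a b => rw [slide_tmul, braidedMul_tmul]; rfl

theorem braidedMul_rmul (b : A) (u v : A ⊗[K] A) :
    braidedMul c u (rmul b v) = rmul b (braidedMul c u v) := by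
  induction v with
  | zero => simp
  | add x y hx hy => simp only [map_add, hx, hy]
  | tmul z w =>
    induction u with
    | zero => simp
    | add x y hx hy => simp only [map_add, LinearMap.add_apply, hx, hy]
    | tmul x y => rw [rmul_tmul, braidedMul_tmul, braidedMul_tmul, rmul_smul, rmul_rmul]

/-- The multiplication of `A ⊗_c A` is associative. -/
theorem braidedMul_assoc (hc : IsRightCross c) (hm : ∀ x y z, c ((x * y) ⊗ₜ[K] z) =
      slide c (LinearMap.mul' K A) (x ⊗ₜ[K] c (y ⊗ₜ[K] z))) (u v w : A ⊗[K] A) :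
    braidedMul c (braidedMul c u v) w = braidedMul c u (braidedMul c v w) := by
  induction u with
  | zero => simp
  | add x y hx hy => simp only [map_add, LinearMap.add_apply, hx, hy]
  | tmul x y =>
    induction v with
    | zero => simp
    | add x y hx hy => simp only [map_add, LinearMap.add_apply, hx, hy]
    | tmul z w' =>
      induction w with
      | zero => simp
      | add x y hx hy => simp only [map_add, hx, hy]
      | tmul p r =>
        -- `h₁` uses multiplicativity of `c` in its first argument, `h₂` in its second. They bring
        -- both bracketings to the form `x • rmul r (braidedMul c (c (y ⊗ z)) (c (w' ⊗ p)))`.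
        have h₁ : ∀ u : A ⊗[K] A, braidedMul c (rmul w' u) (p ⊗ₜ[K] r) =
            rmul r (braidedMul c u (c (w' ⊗ₜ[K] p))) := by
          intro u
          rw [← moveL_rmul hm]
          generalize rmul w' u = v
          induction v with
          | zero => simp
          | add x y hx hy => simp only [map_add, LinearMap.add_apply, hx, hy]
          | tmul a b => rw [braidedMul_tmul, moveL_tmul, rmul_smul]
        have h₂ : ∀ v : A ⊗[K] A, braidedMul c (x ⊗ₜ[K] y) (z • v) =
            x • braidedMul c (c (y ⊗ₜ[K] z)) v := by
          intro v
          induction v with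
          | zero => simp
          | add x y hx hy => simp only [map_add, smul_add, hx, hy]
          | tmul a b =>
            rw [TensorProduct.smul_tmul', smul_eq_mul, braidedMul_tmul, hc.mul]
            generalize c (y ⊗ₜ[K] z) = v
            induction v with
            | zero => simp
            | add x y hx hy => simp only [map_add, smul_add, LinearMap.add_apply, hx, hy]
            | tmul d e => rw [moveL_tmul, braidedMul_tmul, rmul_smul]
        rw [braidedMul_tmul, braidedMul_tmul, braidedMul_smul, h₁, h₂, braidedMul_rmul]

theorem braidedMul_one_tmul (h1 : ∀ a : A, c (1 ⊗ₜ[K] a) = a ⊗ₜ[K] 1) (v : A ⊗[K] A) :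
    braidedMul c (1 ⊗ₜ[K] 1) v = v := by
  induction v with
  | zero => simp
  | add x y hx hy => simp only [map_add, hx, hy]
  | tmul a b => simp [braidedMul_tmul, h1]

theorem braidedMul_tmul_one (hc : IsRightCross c) (u : A ⊗[K] A) :
    braidedMul c u (1 ⊗ₜ[K] 1) = u := by
  induction u with
  | zero => simp
  | add x y hx hy => simp only [map_add, LinearMap.add_apply, hx, hy]
  | tmul a b => simp [braidedMul_tmul, hc.one, TensorProduct.smul_tmul']

end BraidedAlgebras

/-! ### The comultiplication and the counit of the tensor algebra -/

section TensorComul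

open TensorAlgebra (ι)

variable {K : Type*} [Field K] {V : Type*} [AddCommGroup V] [Module K V]
variable {c : V ⊗[K] V →ₗ[K] V ⊗[K] V}

theorem isBraidedAlgebra_tensorBraiding (hc : IsBraiding c) :
    IsBraidedAlgebra (tensorBraiding c) where
  braid := isBraiding_tensorBraiding hc
  mul := (commutesWith_mul_iff _).2
    ⟨tensorBraiding_mul_left c, (isRightCross_tensorBraiding c).mul⟩
  one_left := tensorBraiding_one_left c
  one_right := (isRightCross_tensorBraiding c).one

variable (c) in
theorem tensorComul_one : tensorComul c 1 = 1 ⊗ₜ[K] 1 := by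
  simp [tensorComul]

variable (c) in
theorem tensorComul_mul_ι (x : TensorAlgebra K V) (v : V) : tensorComul c (x * ι K v) =
    braidedMul (tensorBraiding c) (tensorComul c x) (ι K v ⊗ₜ[K] 1 + 1 ⊗ₜ[K] ι K v) := by
  simp [tensorComul, comulStep]

variable (c) in
theorem tensorComul_ι (v : V) :
    tensorComul c (ι K v) = ι K v ⊗ₜ[K] 1 + 1 ⊗ₜ[K] ι K v := by
  have h := tensorComul_mul_ι c 1 v
  rwa [one_mul, tensorComul_one, braidedMul_one_tmul (tensorBraiding_one_left c)] at h

-- The definition only appends letters on the right; associativity of `T ⊗_{c_T} T` makes it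
-- multiplicative.
variable (c) in
theorem tensorComul_mul (x y : TensorAlgebra K V) : tensorComul c (x * y) =
    braidedMul (tensorBraiding c) (tensorComul c x) (tensorComul c y) := by
  induction y using word_induction_right with
  | hadd a b ha hb => simp only [mul_add, map_add, ha, hb]
  | hsmul r a ha => simp only [mul_smul_comm, map_smul, ha]
  | hone => rw [mul_one, tensorComul_one, braidedMul_tmul_one (isRightCross_tensorBraiding c)]
  | hmul v y hy =>
    rw [← mul_assoc, tensorComul_mul_ι, tensorComul_mul_ι, hy,
      braidedMul_assoc (isRightCross_tensorBraiding c) (tensorBraiding_mul_left c)]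

-- The recursion from the left: `ι v ⊗ 1` multiplies the first leg, while `1 ⊗ ι v` crosses the
-- first leg and then multiplies the second. This matches the left recursion of `tensorBraiding`.
variable (c) in
theorem tensorComul_ι_mul (v : V) (x : TensorAlgebra K V) : tensorComul c (ι K v * x) =
    ι K v • tensorComul c x + slide (crossWord c) letterMul (v ⊗ₜ[K] tensorComul c x) := by
  rw [tensorComul_mul, tensorComul_ι]
  generalize tensorComul c x = u
  induction u with
  | zero => simp
  | add a b ha hb =>
    rw [map_add, ha, hb, TensorProduct.tmul_add, map_add, smul_add]; abel
  | tmul a b =>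
    rw [map_add, LinearMap.add_apply, braidedMul_tmul, braidedMul_tmul, tensorBraiding_one_left,
      rmul_tmul, one_mul, one_smul, slide_tmul, tensorBraiding_ι]
    congr 1
    generalize crossWord c (v ⊗ₜ[K] a) = p
    induction p with
    | zero => simp
    | add a b ha hb => simp only [map_add, ha, hb]
    | tmul a b => simp

/-! ### Comultiplication against braiding, and coassociativity -/

variable {X X' Z Z' W W' : Type*} [AddCommGroup X] [Module K X] [AddCommGroup X'] [Module K X']
  [AddCommGroup Z] [Module K Z] [AddCommGroup Z'] [Module K Z']
  [AddCommGroup W] [Module K W] [AddCommGroup W'] [Module K W']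

theorem slide_add (k : X ⊗[K] Z →ₗ[K] Z' ⊗[K] X') (f g : X' ⊗[K] W →ₗ[K] W')
    (u : X ⊗[K] (Z ⊗[K] W)) : slide k (f + g) u = slide k f u + slide k g u := by
  simp [slide, LinearMap.lTensor_add]

theorem tensorComul_comp_letterMul : tensorComul c ∘ₗ letterMul =
    letterSMul K V _ ∘ₗ LinearMap.lTensor V (tensorComul c) +
      slide (crossWord c) letterMul ∘ₗ LinearMap.lTensor V (tensorComul c) :=
  TensorProduct.ext' fun v x => by simp [tensorComul_ι_mul]

/-- For a new first letter the two summands of its comultiplication are handled separately: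
`pairCross_smul` if it stays in the first leg, `pairCross_slide_letterMul` if it goes to the second.
-/
theorem lTensor_tensorComul_tensorBraiding (hc : IsBraiding c) (x z : TensorAlgebra K V) :
    LinearMap.lTensor _ (tensorComul c) (tensorBraiding c (x ⊗ₜ[K] z)) =
      pairCross (tensorBraiding c) (tensorBraiding c) (tensorComul c x ⊗ₜ[K] z) := by
  induction x using word_induction_left with
  | hadd a b ha hb => simp only [TensorProduct.add_tmul, map_add, ha, hb]
  | hsmul r a ha => simp only [← TensorProduct.smul_tmul', map_smul, ha]
  | hone => simp [tensorBraiding_one_left, tensorComul_one, slide_tmul]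
  | hmul v x hx =>
    rw [tensorBraiding_ι_mul, lTensor_slide, tensorComul_comp_letterMul, slide_add,
      ← slide_lTensor, ← slide_lTensor, hx, tensorComul_ι_mul, TensorProduct.add_tmul, map_add,
      pairCross_smul, pairCross_slide_letterMul hc]

theorem assoc_smul {A : Type*} [Ring A] [Algebra K A] (a : A) (u : (A ⊗[K] X) ⊗[K] Z) :
    TensorProduct.assoc K A X Z (a • u) = a • TensorProduct.assoc K A X Z u := by
  induction u with
  | zero => simp
  | add u v hu hv => simp only [smul_add, map_add, hu, hv]
  | tmul u z =>
    induction u with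
    | zero => simp
    | add u v hu hv => simp only [TensorProduct.add_tmul, smul_add, map_add, hu, hv]
    | tmul b x => simp [TensorProduct.smul_tmul']

theorem assoc_slide (k : X ⊗[K] Z →ₗ[K] Z' ⊗[K] X') (f : X' ⊗[K] W →ₗ[K] W') (x : X)
    (u : Z ⊗[K] W) (y : V) : TensorProduct.assoc K Z' W' V (slide k f (x ⊗ₜ[K] u) ⊗ₜ[K] y) =
      slide k (LinearMap.rTensor V f ∘ₗ (TensorProduct.assoc K X' W V).symm.toLinearMap)
        (x ⊗ₜ[K] TensorProduct.assoc K Z W V (u ⊗ₜ[K] y)) := by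
  induction u with
  | zero => simp
  | add u v hu hv =>
    simp only [TensorProduct.tmul_add, TensorProduct.add_tmul, map_add, hu, hv]
  | tmul z w =>
    rw [TensorProduct.assoc_tmul, slide_tmul, slide_tmul]
    generalize k (x ⊗ₜ[K] z) = p
    induction p with
    | zero => simp
    | add a b ha hb => simp only [TensorProduct.add_tmul, map_add, ha, hb]
    | tmul a b => simp

theorem rTensor_tensorComul_smul (v : V) (u : TensorAlgebra K V ⊗[K] X) :
    TensorProduct.assoc K _ _ _ (LinearMap.rTensor X (tensorComul c) (ι K v • u)) =
      ι K v • TensorProduct.assoc K _ _ _ (LinearMap.rTensor X (tensorComul c) u) +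
        slide (crossWord c) (letterSMul K V X) (v ⊗ₜ[K] TensorProduct.assoc K _ _ _
          (LinearMap.rTensor X (tensorComul c) u)) := by
  induction u with
  | zero => simp
  | add a b ha hb =>
    simp only [smul_add, map_add, ha, hb, TensorProduct.tmul_add]; abel
  | tmul a x =>
    simp only [TensorProduct.smul_tmul', smul_eq_mul, LinearMap.rTensor_tmul, tensorComul_ι_mul,
      TensorProduct.add_tmul, map_add, assoc_slide, ← assoc_smul]
    rfl

/-- A letter may cross `z` before or after `z` is split. Peel off the first letter `u` of `z`: when
`u` goes to the second leg, the braid equation is needed, through `slide_slide_letterMul`. -/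
theorem rTensor_tensorComul_crossWord (hc : IsBraiding c) (v : V) (z : TensorAlgebra K V) :
    TensorProduct.assoc K _ _ _
        (LinearMap.rTensor V (tensorComul c) (crossWord c (v ⊗ₜ[K] z))) =
      slide (crossWord c) (crossWord c) (v ⊗ₜ[K] tensorComul c z) := by
  induction z using word_induction_left generalizing v with
  | hadd a b ha hb => simp only [TensorProduct.tmul_add, map_add, ha, hb]
  | hsmul r a ha => simp only [TensorProduct.tmul_smul, map_smul, ha]
  | hone => simp [crossWord_one, tensorComul_one, slide_tmul]
  | hmul u z hz =>
    rw [tensorComul_ι_mul, TensorProduct.tmul_add, map_add,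
      slide_smul (isRightCross_crossWord c), slide_slide_letterMul hc, crossWord_ι_mul,
      crossWord_ι]
    generalize c (v ⊗ₜ[K] u) = p
    induction p with
    | zero => simp
    | add a b ha hb => simp only [map_add, ha, hb]; abel
    | tmul u v =>
      rw [LinearMap.rTensor_tmul, moveL_tmul, rTensor_tensorComul_smul, hz, linExt_tmul,
        LinearMap.lTensor_tmul, appRight_apply]
      rfl

theorem rTensor_tensorComul_slide (hc : IsBraiding c) (v : V)
    (p : TensorAlgebra K V ⊗[K] TensorAlgebra K V) :
    TensorProduct.assoc K _ _ _ (LinearMap.rTensor _ (tensorComul c)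
        (slide (crossWord c) letterMul (v ⊗ₜ[K] p))) =
      slide (crossWord c) (slide (crossWord c) letterMul)
        (v ⊗ₜ[K] TensorProduct.assoc K _ _ _ (LinearMap.rTensor _ (tensorComul c) p)) := by
  induction p with
  | zero => simp
  | add a b ha hb => simp only [TensorProduct.tmul_add, map_add, ha, hb]
  | tmul a b =>
    have h : ∀ u : TensorAlgebra K V ⊗[K] V, TensorProduct.assoc K _ _ _
        (LinearMap.rTensor _ (tensorComul c)
          (LinearMap.lTensor _ (appRight letterMul b) u)) =
        LinearMap.lTensor _ (LinearMap.lTensor _ (appRight letterMul b))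
          (TensorProduct.assoc K _ _ _ (LinearMap.rTensor _ (tensorComul c) u)) := by
      intro u
      induction u with
      | zero => simp
      | add a b ha hb => simp only [map_add, ha, hb]
      | tmul x v =>
        simp only [LinearMap.lTensor_tmul, LinearMap.rTensor_tmul]
        generalize tensorComul c x = u
        induction u with
        | zero => simp
        | add a b ha hb => simp only [TensorProduct.add_tmul, map_add, ha, hb]
        | tmul x y => simp
    have h' : ∀ u : TensorAlgebra K V ⊗[K] TensorAlgebra K V,
        TensorProduct.assoc K _ _ _ (u ⊗ₜ[K] b) = LinearMap.lTensor _
          ((TensorProduct.mk K (TensorAlgebra K V) (TensorAlgebra K V)).flip b) u := by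
      intro u
      induction u with
      | zero => simp
      | add a b ha hb => simp only [TensorProduct.add_tmul, map_add, ha, hb]
      | tmul x y => simp
    rw [slide_tmul, h, rTensor_tensorComul_crossWord hc, LinearMap.rTensor_tmul, h',
      slide_lTensor, lTensor_slide]
    congr 1
    congr 1
    refine TensorProduct.ext' fun v y => ?_
    simp [slide_tmul]

theorem rTensor_tensorComul_tensorBraiding (hc : IsBraiding c) (x z : TensorAlgebra K V) :
    TensorProduct.assoc K _ _ _
        (LinearMap.rTensor _ (tensorComul c) (tensorBraiding c (x ⊗ₜ[K] z))) =
      slide (tensorBraiding c) (tensorBraiding c) (x ⊗ₜ[K] tensorComul c z) := by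
  induction x using word_induction_left with
  | hadd a b ha hb => simp only [TensorProduct.add_tmul, map_add, ha, hb]
  | hsmul r a ha => simp only [← TensorProduct.smul_tmul', map_smul, ha]
  | hone =>
    rw [tensorBraiding_one_left, LinearMap.rTensor_tmul]
    generalize tensorComul c z = u
    induction u with
    | zero => simp
    | add a b ha hb => simp only [TensorProduct.tmul_add, TensorProduct.add_tmul, map_add, ha, hb]
    | tmul a b => simp [slide_tmul, tensorBraiding_one_left]
  | hmul v x hx =>
    rw [tensorBraiding_ι_mul, rTensor_tensorComul_slide hc, hx]
    exact (slide_ι_mul v x _ _ (tensorBraiding_ι_mul c) _).symm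

/-- A new first letter ends in the first, second or third leg of the iterated comultiplication; both
sides are the sum of the same three terms. -/
theorem tensorComul_coassoc (hc : IsBraiding c) (x : TensorAlgebra K V) :
    TensorProduct.assoc K _ _ _ (LinearMap.rTensor _ (tensorComul c) (tensorComul c x)) =
      LinearMap.lTensor _ (tensorComul c) (tensorComul c x) := by
  induction x using word_induction_left with
  | hadd a b ha hb => simp only [map_add, ha, hb]
  | hsmul r a ha => simp only [map_smul, ha]
  | hone => simp [tensorComul_one]
  | hmul v x hx =>
    rw [tensorComul_ι_mul, map_add, map_add, map_add, rTensor_tensorComul_smul,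
      rTensor_tensorComul_slide hc, hx, lTensor_smul, lTensor_slide, tensorComul_comp_letterMul,
      slide_add, ← slide_lTensor, ← slide_lTensor, add_assoc]

/-! ### The counit of the tensor algebra -/

variable (c) in
theorem tensorCounit_one : (tensorData c).counit 1 = 1 := map_one (TensorAlgebra.lift K 0)

variable (c) in
theorem tensorCounit_mul (x y : TensorAlgebra K V) :
    (tensorData c).counit (x * y) = (tensorData c).counit x * (tensorData c).counit y :=
  map_mul (TensorAlgebra.lift K 0) x y

variable (c) in
@[simp] theorem tensorCounit_ι (v : V) : (tensorData c).counit (ι K v) = 0 := by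
  simp [tensorData]

theorem rTensor_counit_crossWord (v : V) (z : TensorAlgebra K V) :
    LinearMap.rTensor V (tensorData c).counit (crossWord c (v ⊗ₜ[K] z)) =
      (tensorData c).counit z ⊗ₜ[K] v := by
  induction z using word_induction_right with
  | hadd a b ha hb => simp only [TensorProduct.tmul_add, TensorProduct.add_tmul, map_add, ha, hb]
  | hsmul r a ha =>
    rw [TensorProduct.tmul_smul, map_smul, map_smul, ha, map_smul, TensorProduct.smul_tmul']
  | hone => simp [crossWord_one, tensorCounit_one]
  | hmul w z hz =>
    rw [crossWord_mul_ι, tensorCounit_mul, tensorCounit_ι, mul_zero, TensorProduct.zero_tmul]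
    generalize crossWord c (v ⊗ₜ[K] z) = p
    induction p with
    | zero => simp
    | add a b ha hb => simp only [map_add, ha, hb, add_zero]
    | tmul a b =>
      rw [crossStepRight_tmul]
      generalize c (b ⊗ₜ[K] w) = p
      induction p with
      | zero => simp
      | add a b ha hb => simp only [map_add, smul_add, ha, hb, add_zero]
      | tmul d e => simp [TensorProduct.smul_tmul', tensorCounit_mul]

theorem rTensor_counit_slide (v : V) (p : TensorAlgebra K V ⊗[K] TensorAlgebra K V) :
    LinearMap.rTensor _ (tensorData c).counit (slide (crossWord c) letterMul (v ⊗ₜ[K] p)) =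
      LinearMap.lTensor K (LinearMap.mulLeft K (ι K v))
        (LinearMap.rTensor _ (tensorData c).counit p) := by
  induction p with
  | zero => simp
  | add a b ha hb => simp only [TensorProduct.tmul_add, map_add, ha, hb]
  | tmul a b =>
    rw [slide_tmul, ← LinearMap.comp_apply, LinearMap.rTensor_comp_lTensor,
      ← LinearMap.lTensor_comp_rTensor, LinearMap.comp_apply, rTensor_counit_crossWord]
    simp

theorem rTensor_counit_tensorBraiding (x y : TensorAlgebra K V) :
    LinearMap.rTensor _ (tensorData c).counit (tensorBraiding c (x ⊗ₜ[K] y)) =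
      (tensorData c).counit y ⊗ₜ[K] x := by
  induction x using word_induction_left with
  | hadd a b ha hb => simp only [TensorProduct.tmul_add, TensorProduct.add_tmul, map_add, ha, hb]
  | hsmul r a ha => simp only [← TensorProduct.smul_tmul', TensorProduct.tmul_smul, map_smul, ha]
  | hone => simp [tensorBraiding_one_left]
  | hmul v x hx => rw [tensorBraiding_ι_mul, rTensor_counit_slide, hx]; simp

theorem lTensor_counit_slide (v : V) (p : TensorAlgebra K V ⊗[K] TensorAlgebra K V) :
    LinearMap.lTensor _ (tensorData c).counit (slide (crossWord c) letterMul (v ⊗ₜ[K] p)) = 0 := by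
  have h : (tensorData c).counit ∘ₗ letterMul = 0 :=
    TensorProduct.ext' fun v x => by simp [tensorCounit_mul]
  rw [lTensor_slide, h]
  simp [slide]

theorem lTensor_counit_tensorBraiding (x y : TensorAlgebra K V) :
    LinearMap.lTensor _ (tensorData c).counit (tensorBraiding c (y ⊗ₜ[K] x)) =
      x ⊗ₜ[K] (tensorData c).counit y := by
  induction y using word_induction_left with
  | hadd a b ha hb => simp only [TensorProduct.tmul_add, TensorProduct.add_tmul, map_add, ha, hb]
  | hsmul r a ha => simp only [← TensorProduct.smul_tmul', TensorProduct.tmul_smul, map_smul, ha]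
  | hone => simp [tensorBraiding_one_left]
  | hmul v y hy =>
    rw [tensorBraiding_ι_mul, lTensor_counit_slide, tensorCounit_mul, tensorCounit_ι]; simp

theorem rTensor_counit_tensorComul (x : TensorAlgebra K V) :
    LinearMap.rTensor _ (tensorData c).counit (tensorComul c x) = 1 ⊗ₜ[K] x := by
  induction x using word_induction_left with
  | hadd a b ha hb => simp only [TensorProduct.tmul_add, map_add, ha, hb]
  | hsmul r a ha => simp only [TensorProduct.tmul_smul, map_smul, ha]
  | hone => simp [tensorComul_one, tensorCounit_one]
  | hmul v x hx =>
    have h : ∀ u : TensorAlgebra K V ⊗[K] TensorAlgebra K V,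
        LinearMap.rTensor _ (tensorData c).counit (ι K v • u) = 0 := by
      intro u
      induction u with
      | zero => simp
      | add a b ha hb => simp only [map_add, smul_add, ha, hb, add_zero]
      | tmul a b => simp [TensorProduct.smul_tmul', tensorCounit_mul]
    rw [tensorComul_ι_mul, map_add, h, rTensor_counit_slide, hx]
    simp

theorem lTensor_counit_tensorComul (x : TensorAlgebra K V) :
    LinearMap.lTensor _ (tensorData c).counit (tensorComul c x) = x ⊗ₜ[K] 1 := by
  induction x using word_induction_left with
  | hadd a b ha hb => simp only [TensorProduct.add_tmul, map_add, ha, hb]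
  | hsmul r a ha => simp only [← TensorProduct.smul_tmul', map_smul, ha]
  | hone => simp [tensorComul_one, tensorCounit_one]
  | hmul v x hx =>
    rw [tensorComul_ι_mul, map_add, lTensor_counit_slide, lTensor_smul, hx, add_zero]
    simp [TensorProduct.smul_tmul']

theorem cOne_cTwo {W : Type*} [AddCommGroup W] [Module K W] (c : W ⊗[K] W →ₗ[K] W ⊗[K] W)
    (u : (W ⊗[K] W) ⊗[K] W) :
    cOne c (cTwo c u) = (TensorProduct.assoc K W W W).symm (pairCross c c u) := by
  simp [pairCross, slide, cOne, cTwo, onFirst, onLast]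

theorem cTwo_cOne {W : Type*} [AddCommGroup W] [Module K W] (c : W ⊗[K] W →ₗ[K] W ⊗[K] W)
    (u : W ⊗[K] (W ⊗[K] W)) : cTwo c (cOne c ((TensorProduct.assoc K W W W).symm u)) =
      (TensorProduct.assoc K W W W).symm (slide c c u) := by
  simp [slide, cOne, cTwo, onFirst, onLast]

/-- `T(V, c)` is a braided bialgebra. -/
theorem isBraidedBialgebra_tensorData (hc : IsBraiding c) :
    IsBraidedBialgebra (tensorData c) where
  algebra := isBraidedAlgebra_tensorBraiding hc
  coalgebra :=
    { braid := isBraiding_tensorBraiding hc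
      coassoc := LinearMap.ext (tensorComul_coassoc hc)
      counit_left := rTensor_counit_tensorComul
      counit_right := lTensor_counit_tensorComul
      comul_right := TensorProduct.ext' fun x y =>
        (congrArg _ (lTensor_tensorComul_tensorBraiding hc x y)).trans (cOne_cTwo _ _).symm
      comul_left := TensorProduct.ext' fun x y =>
        ((TensorProduct.assoc K _ _ _).symm_apply_eq.2
          (rTensor_tensorComul_tensorBraiding hc x y).symm).symm.trans (cTwo_cOne _ _).symm
      counit_braid_left := rTensor_counit_tensorBraiding
      counit_braid_right := lTensor_counit_tensorBraiding }
  comul_one := tensorComul_one c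
  comul_mul := tensorComul_mul c
  counit_one := tensorCounit_one c
  counit_mul := tensorCounit_mul c

end TensorComul

/-! ### Quotients of braided bialgebras -/

section Quotients

variable {K : Type*} [Field K] {A B : Type*} [Ring A] [Algebra K A] [Ring B] [Algebra K B]

theorem map_braidedMul {c : A ⊗[K] A →ₗ[K] A ⊗[K] A} {c' : B ⊗[K] B →ₗ[K] B ⊗[K] B}
    (g : A →ₐ[K] B) (hg : IsBraidedHom c c' g.toLinearMap) (u v : A ⊗[K] A) :
    TensorProduct.map g.toLinearMap g.toLinearMap (braidedMul c u v) =
      braidedMul c' (TensorProduct.map g.toLinearMap g.toLinearMap u)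
        (TensorProduct.map g.toLinearMap g.toLinearMap v) := by
  induction u with
  | zero => simp
  | add x y hx hy => simp only [map_add, LinearMap.add_apply, hx, hy]
  | tmul x y =>
    induction v with
    | zero => simp
    | add x y hx hy => simp only [map_add, hx, hy]
    | tmul z w =>
      have h := LinearMap.congr_fun hg (y ⊗ₜ[K] z)
      simp only [LinearMap.comp_apply, TensorProduct.map_tmul, AlgHom.toLinearMap_apply] at h
      simp only [TensorProduct.map_tmul, AlgHom.toLinearMap_apply]
      rw [braidedMul_tmul, braidedMul_tmul, h]
      generalize c (y ⊗ₜ[K] z) = p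
      induction p with
      | zero => simp
      | add a b ha hb => simp only [map_add, smul_add, ha, hb]
      | tmul a b => simp [TensorProduct.smul_tmul']

variable {M N M' N' : Type*} [AddCommGroup M] [Module K M] [AddCommGroup N] [Module K N]
  [AddCommGroup M'] [Module K M'] [AddCommGroup N'] [Module K N']

/-- The targets are arbitrary so that braidings, multiplications and brackets are all covered. -/
theorem onFirst_map {α : M ⊗[K] M →ₗ[K] M'} {α' : N ⊗[K] N →ₗ[K] N'} {g : M →ₗ[K] N}
    {h : M' →ₗ[K] N'} (H : α' ∘ₗ TensorProduct.map g g = h ∘ₗ α) (u : (M ⊗[K] M) ⊗[K] M) :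
    onFirst α' (TensorProduct.map (TensorProduct.map g g) g u) =
      TensorProduct.map h g (onFirst α u) := by
  rw [onFirst, onFirst, ← LinearMap.comp_apply, LinearMap.rTensor_comp_map, H,
    ← LinearMap.map_comp_rTensor, LinearMap.comp_apply]

theorem onLast_map {α : M ⊗[K] M →ₗ[K] M'} {α' : N ⊗[K] N →ₗ[K] N'} {g : M →ₗ[K] N}
    {h : M' →ₗ[K] N'} (H : α' ∘ₗ TensorProduct.map g g = h ∘ₗ α) (u : (M ⊗[K] M) ⊗[K] M) :
    onLast α' (TensorProduct.map (TensorProduct.map g g) g u) =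
      TensorProduct.map g h (onLast α u) := by
  have e : TensorProduct.assoc K N N N (TensorProduct.map (TensorProduct.map g g) g u) =
      TensorProduct.map g (TensorProduct.map g g) (TensorProduct.assoc K M M M u) := by
    rw [TensorProduct.map_map_assoc]
  rw [onLast, onLast, LinearMap.comp_apply, LinearEquiv.coe_coe, e, ← LinearMap.comp_apply,
    LinearMap.lTensor_comp_map, H, ← LinearMap.map_comp_lTensor]
  rfl

theorem assoc_symm_map {g : M →ₗ[K] N} (u : M ⊗[K] (M ⊗[K] M)) :
    (TensorProduct.assoc K N N N).symm (TensorProduct.map g (TensorProduct.map g g) u) =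
      TensorProduct.map (TensorProduct.map g g) g ((TensorProduct.assoc K M M M).symm u) := by
  rw [TensorProduct.map_map_assoc_symm]

theorem cTwo_map {c : M ⊗[K] M →ₗ[K] M ⊗[K] M} {c' : N ⊗[K] N →ₗ[K] N ⊗[K] N} {g : M →ₗ[K] N}
    (H : IsBraidedHom c c' g) (u : (M ⊗[K] M) ⊗[K] M) :
    cTwo c' (TensorProduct.map (TensorProduct.map g g) g u) =
      TensorProduct.map (TensorProduct.map g g) g (cTwo c u) := by
  rw [cTwo, LinearMap.comp_apply, onLast_map H, LinearEquiv.coe_coe, assoc_symm_map]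
  rfl

theorem cOne_map {c : M ⊗[K] M →ₗ[K] M ⊗[K] M} {c' : N ⊗[K] N →ₗ[K] N ⊗[K] N} {g : M →ₗ[K] N}
    (H : IsBraidedHom c c' g) (u : (M ⊗[K] M) ⊗[K] M) :
    cOne c' (TensorProduct.map (TensorProduct.map g g) g u) =
      TensorProduct.map (TensorProduct.map g g) g (cOne c u) :=
  onFirst_map H u

/-- The axioms of braided bialgebras pass to quotients. -/
theorem IsBraidedBialgebra.of_surjective {S : BialgebraData K A} {S' : BialgebraData K B}
    (hS : IsBraidedBialgebra S) (g : A →ₐ[K] B) (hg : IsBialgebraHom S S' g)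
    (hsurj : Function.Surjective g) : IsBraidedBialgebra S' := by
  set G := g.toLinearMap with hG
  -- Each axiom can be tested on elements of `B`, `B ⊗ B` or `B ⊗ B ⊗ B` that are images from `A`,
  -- where it follows from the same axiom for `S`.
  have s₁ : Function.Surjective G := hsurj
  have s₂ : Function.Surjective (TensorProduct.map G G) := TensorProduct.map_surjective s₁ s₁
  have s₃ : Function.Surjective (TensorProduct.map (TensorProduct.map G G) G) :=
    TensorProduct.map_surjective s₂ s₁
  have hb : ∀ u, S'.braiding (TensorProduct.map G G u) = TensorProduct.map G G (S.braiding u) :=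
    LinearMap.congr_fun hg.braiding
  have hb' : ∀ x y, S'.braiding (G x ⊗ₜ[K] G y) =
    TensorProduct.map G G (S.braiding (x ⊗ₜ[K] y)) := fun x y => hb (x ⊗ₜ[K] y)
  have hΔ : ∀ x, S'.comul (G x) = TensorProduct.map G G (S.comul x) :=
    LinearMap.congr_fun hg.comul
  have hε : ∀ x, S'.counit (G x) = S.counit x := LinearMap.congr_fun hg.counit
  have hm : LinearMap.mul' K B ∘ₗ TensorProduct.map G G = G ∘ₗ LinearMap.mul' K A :=
    TensorProduct.ext' fun x y => by simp [hG]
  have h1 : G 1 = 1 := map_one g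
  have hc₁ : ∀ u, cOne S'.braiding (TensorProduct.map (TensorProduct.map G G) G u) =
      TensorProduct.map (TensorProduct.map G G) G (cOne S.braiding u) := cOne_map hg.braiding
  have hc₂ : ∀ u, cTwo S'.braiding (TensorProduct.map (TensorProduct.map G G) G u) =
      TensorProduct.map (TensorProduct.map G G) G (cTwo S.braiding u) := cTwo_map hg.braiding
  have hbraid : IsBraiding S'.braiding := by
    refine LinearMap.ext fun u => ?_
    obtain ⟨u, rfl⟩ := s₃ u
    simp only [LinearMap.comp_apply, hc₁, hc₂]
    exact congrArg _ (LinearMap.congr_fun hS.algebra.braid u)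
  have hr : ∀ u, LinearMap.rTensor B S'.comul (TensorProduct.map G G u) =
      TensorProduct.map (TensorProduct.map G G) G (LinearMap.rTensor A S.comul u) := by
    intro u
    rw [← LinearMap.comp_apply, LinearMap.rTensor_comp_map, hg.comul,
      ← LinearMap.map_comp_rTensor, LinearMap.comp_apply]
  have hl : ∀ u, LinearMap.lTensor B S'.comul (TensorProduct.map G G u) =
      TensorProduct.map G (TensorProduct.map G G) (LinearMap.lTensor A S.comul u) := by
    intro u
    rw [← LinearMap.comp_apply, LinearMap.lTensor_comp_map, hg.comul,
      ← LinearMap.map_comp_lTensor, LinearMap.comp_apply]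
  have her : ∀ u, LinearMap.rTensor B S'.counit (TensorProduct.map G G u) =
      LinearMap.lTensor K G (LinearMap.rTensor A S.counit u) := by
    intro u
    rw [← LinearMap.comp_apply, LinearMap.rTensor_comp_map, hg.counit,
      ← LinearMap.lTensor_comp_rTensor, LinearMap.comp_apply]
  have hel : ∀ u, LinearMap.lTensor B S'.counit (TensorProduct.map G G u) =
      LinearMap.rTensor K G (LinearMap.lTensor A S.counit u) := by
    intro u
    rw [← LinearMap.comp_apply, LinearMap.lTensor_comp_map, hg.counit,
      ← LinearMap.rTensor_comp_lTensor, LinearMap.comp_apply]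
  refine ⟨⟨hbraid, ⟨?_, ?_⟩, ?_, ?_⟩, ⟨hbraid, ?_, ?_, ?_, ?_, ?_, ?_, ?_⟩, ?_, ?_, ?_, ?_⟩
  · refine LinearMap.ext fun u => ?_
    obtain ⟨u, rfl⟩ := s₃ u
    simp only [LinearMap.comp_apply, hc₁, hc₂, onFirst_map hm, onLast_map hm, hb]
    exact congrArg _ (LinearMap.congr_fun hS.algebra.mul.1 u)
  · refine LinearMap.ext fun u => ?_
    obtain ⟨u, rfl⟩ := s₃ u
    simp only [LinearMap.comp_apply, hc₁, hc₂, onFirst_map hm, onLast_map hm, hb]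
    exact congrArg _ (LinearMap.congr_fun hS.algebra.mul.2 u)
  · intro a
    obtain ⟨a, rfl⟩ := s₁ a
    rw [← h1, hb', hS.algebra.one_left, TensorProduct.map_tmul]
  · intro a
    obtain ⟨a, rfl⟩ := s₁ a
    rw [← h1, hb', hS.algebra.one_right, TensorProduct.map_tmul]
  · refine LinearMap.ext fun u => ?_
    obtain ⟨u, rfl⟩ := s₁ u
    simp only [LinearMap.comp_apply, hΔ, hr, hl]
    rw [LinearEquiv.coe_coe, ← TensorProduct.map_map_assoc]
    exact congrArg _ (LinearMap.congr_fun hS.coalgebra.coassoc u)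
  · intro x
    obtain ⟨x, rfl⟩ := s₁ x
    rw [hΔ, her, hS.coalgebra.counit_left, LinearMap.lTensor_tmul]
  · intro x
    obtain ⟨x, rfl⟩ := s₁ x
    rw [hΔ, hel, hS.coalgebra.counit_right, LinearMap.rTensor_tmul]
  · refine LinearMap.ext fun u => ?_
    obtain ⟨u, rfl⟩ := s₂ u
    simp only [LinearMap.comp_apply, hb, hr, hl, hc₁, hc₂, LinearEquiv.coe_coe, assoc_symm_map]
    exact congrArg _ (LinearMap.congr_fun hS.coalgebra.comul_right u)
  · refine LinearMap.ext fun u => ?_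
    obtain ⟨u, rfl⟩ := s₂ u
    simp only [LinearMap.comp_apply, hb, hr, hl, hc₁, hc₂, LinearEquiv.coe_coe, assoc_symm_map]
    exact congrArg _ (LinearMap.congr_fun hS.coalgebra.comul_left u)
  · intro x y
    obtain ⟨x, rfl⟩ := s₁ x
    obtain ⟨y, rfl⟩ := s₁ y
    rw [hb', her, hS.coalgebra.counit_braid_left, LinearMap.lTensor_tmul, hε]
  · intro x y
    obtain ⟨x, rfl⟩ := s₁ x
    obtain ⟨y, rfl⟩ := s₁ y
    rw [hb', hel, hS.coalgebra.counit_braid_right, LinearMap.rTensor_tmul, hε]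
  · rw [← h1, hΔ, hS.comul_one, TensorProduct.map_tmul]
  · intro x y
    obtain ⟨x, rfl⟩ := s₁ x
    obtain ⟨y, rfl⟩ := s₁ y
    have : G x * G y = G (x * y) := (map_mul g x y).symm
    rw [this, hΔ, hΔ, hΔ, hS.comul_mul, map_braidedMul g hg.braiding]
  · rw [← h1, hε, hS.counit_one]
  · intro x y
    obtain ⟨x, rfl⟩ := s₁ x
    obtain ⟨y, rfl⟩ := s₁ y
    have : G x * G y = G (x * y) := (map_mul g x y).symm
    rw [this, hε, hε, hε, hS.counit_mul]

/-- A map out of a quotient is a morphism if it is one before passing to the quotient. -/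
theorem IsBialgebraHom.of_comp {C : Type*} [Ring C] [Algebra K C] {S : BialgebraData K A}
    {S' : BialgebraData K B} {S'' : BialgebraData K C} {p : A →ₐ[K] B} {g : B →ₐ[K] C}
    (hp : IsBialgebraHom S S' p) (hsurj : Function.Surjective p)
    (h : IsBialgebraHom S S'' (g.comp p)) : IsBialgebraHom S' S'' g := by
  have s₁ : Function.Surjective p.toLinearMap := hsurj
  have s₂ : Function.Surjective (TensorProduct.map p.toLinearMap p.toLinearMap) :=
    TensorProduct.map_surjective s₁ s₁
  have e : ∀ u, TensorProduct.map (g.comp p).toLinearMap (g.comp p).toLinearMap u =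
      TensorProduct.map g.toLinearMap g.toLinearMap
        (TensorProduct.map p.toLinearMap p.toLinearMap u) := by
    intro u
    rw [AlgHom.comp_toLinearMap, TensorProduct.map_comp, LinearMap.comp_apply]
  refine ⟨LinearMap.ext fun u => ?_, LinearMap.ext fun u => ?_, LinearMap.ext fun u => ?_⟩
  · obtain ⟨u, rfl⟩ := s₂ u
    have h₁ := LinearMap.congr_fun h.braiding u
    have h₂ := LinearMap.congr_fun hp.braiding u
    simp only [LinearMap.comp_apply, e] at h₁ h₂ ⊢
    rw [h₁, h₂]
  · obtain ⟨u, rfl⟩ := s₁ u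
    have h₁ := LinearMap.congr_fun h.comul u
    have h₂ := LinearMap.congr_fun hp.comul u
    simp only [LinearMap.comp_apply, e] at h₁ h₂ ⊢
    rw [h₂, ← h₁]
    rfl
  · obtain ⟨u, rfl⟩ := s₁ u
    exact (LinearMap.congr_fun h.counit u).trans (LinearMap.congr_fun hp.counit u).symm

end Quotients

/-! ### The bialgebra structure of the enveloping algebra -/

section EnvelopingStructure

open TensorAlgebra (ι)

variable {K : Type*} [Field K] {V : Type*} [AddCommGroup V] [Module K V]
variable {c : V ⊗[K] V →ₗ[K] V ⊗[K] V} {b : V ⊗[K] V →ₗ[K] V} {q : K}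

variable (K V) in
/-- The inclusion of `V ⊗ V` into the tensor algebra. -/
def twoLetters : V ⊗[K] V →ₗ[K] TensorAlgebra K V :=
  LinearMap.mul' K (TensorAlgebra K V) ∘ₗ TensorProduct.map (ι K) (ι K)

@[simp] theorem twoLetters_tmul (v w : V) : twoLetters K V (v ⊗ₜ[K] w) = ι K v * ι K w := by
  simp [twoLetters]

variable (c b q) in
/-- The relators `c z - q z - b z` of the enveloping algebra. -/
def relator : V ⊗[K] V →ₗ[K] TensorAlgebra K V :=
  twoLetters K V ∘ₗ heckeDiff c q - ι K ∘ₗ b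

theorem tensorBraiding_twoLetters (z : V ⊗[K] V) (y : TensorAlgebra K V) :
    tensorBraiding c (twoLetters K V z ⊗ₜ[K] y) = LinearMap.lTensor _ (twoLetters K V)
      (pairCross (crossWord c) (crossWord c) (z ⊗ₜ[K] y)) := by
  induction z with
  | zero => simp
  | add x y hx hy => simp only [TensorProduct.add_tmul, map_add, hx, hy]
  | tmul v u =>
    rw [twoLetters_tmul, tensorBraiding_ι_mul, tensorBraiding_ι, slide_lTensor, pairCross_tmul,
      lTensor_slide]
    congr 1
    congr 1
    exact TensorProduct.ext' fun v u => by simp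

/-- Naturality of the pair crossing with respect to `b`: on one letter it is the first bracket
identity, and multiplicativity extends it to words. -/
theorem crossWord_bracket (hb : IsBracket c b) (z : V ⊗[K] V) (y : TensorAlgebra K V) :
    crossWord c (b z ⊗ₜ[K] y) = LinearMap.lTensor _ b
      (pairCross (crossWord c) (crossWord c) (z ⊗ₜ[K] y)) := by
  have hk := isRightCross_crossWord c
  refine (hk.pairCross hk).natural hk b (fun z w => ?_) z y
  have h : c (b z ⊗ₜ[K] w) = LinearMap.lTensor V b (pairCross c c (z ⊗ₜ[K] w)) := by
    refine (LinearMap.congr_fun hb.1 (z ⊗ₜ[K] w)).trans ?_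
    simp [cOne_cTwo, onLast]
  rw [pairCross_crossWord_ι, crossWord_ι, h]
  exact LinearMap.congr_fun ((LinearMap.rTensor_comp_lTensor _ _ _).trans
    (LinearMap.lTensor_comp_rTensor _ _ _).symm) _

/-- The braid equation carries `c - q` across the word and the bracket identity carries `b`, so a
relator crosses as a relator. -/
theorem tensorBraiding_relator_left (hc : IsBraiding c) (hb : IsBracket c b) (z : V ⊗[K] V)
    (y : TensorAlgebra K V) :
    tensorBraiding c (relator c b q z ⊗ₜ[K] y) = LinearMap.lTensor _ (relator c b q)
      (pairCross (crossWord c) (crossWord c) (z ⊗ₜ[K] y)) := by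
  have h : pairCross (crossWord c) (crossWord c) (heckeDiff c q z ⊗ₜ[K] y) =
      LinearMap.lTensor _ (heckeDiff c q)
        (pairCross (crossWord c) (crossWord c) (z ⊗ₜ[K] y)) := by
    simp only [heckeDiff, LinearMap.sub_apply, LinearMap.smul_apply, LinearMap.id_apply,
      TensorProduct.sub_tmul, map_sub, braid_letter_letter_word hc, ← TensorProduct.smul_tmul',
      map_smul, LinearMap.lTensor_sub, LinearMap.lTensor_smul, LinearMap.lTensor_id]
  rw [relator, LinearMap.sub_apply, LinearMap.comp_apply, LinearMap.comp_apply,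
    TensorProduct.sub_tmul, map_sub, tensorBraiding_twoLetters, h, tensorBraiding_ι,
    crossWord_bracket hb, LinearMap.lTensor_sub, LinearMap.lTensor_comp, LinearMap.lTensor_comp]
  rfl

theorem crossWord_twoLetters (v : V) (z : V ⊗[K] V) :
    crossWord c (v ⊗ₜ[K] twoLetters K V z) = LinearMap.rTensor V (twoLetters K V)
      ((TensorProduct.assoc K V V V).symm (slide c c (v ⊗ₜ[K] z))) := by
  induction z with
  | zero => simp
  | add x y hx hy => simp only [TensorProduct.tmul_add, map_add, hx, hy]
  | tmul u w =>
    rw [twoLetters_tmul, crossWord_ι_mul, slide_tmul]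
    generalize c (v ⊗ₜ[K] u) = p
    induction p with
    | zero => simp
    | add x y hx hy => simp only [map_add, hx, hy]
    | tmul u v =>
      rw [LinearMap.rTensor_tmul, moveL_tmul, LinearMap.lTensor_tmul, appRight_apply, crossWord_ι]
      generalize c (v ⊗ₜ[K] w) = p
      induction p with
      | zero => simp
      | add x y hx hy => simp only [TensorProduct.tmul_add, smul_add, map_add, hx, hy]
      | tmul u v => simp [TensorProduct.smul_tmul']

theorem slide_braid (hc : IsBraiding c) (v : V) (z : V ⊗[K] V) :
    (TensorProduct.assoc K V V V).symm (slide c c (v ⊗ₜ[K] c z)) =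
      LinearMap.rTensor V c ((TensorProduct.assoc K V V V).symm (slide c c (v ⊗ₜ[K] z))) := by
  have h := LinearMap.congr_fun hc ((TensorProduct.assoc K V V V).symm (v ⊗ₜ[K] z))
  have h' : cTwo c ((TensorProduct.assoc K V V V).symm (v ⊗ₜ[K] z)) =
      (TensorProduct.assoc K V V V).symm (v ⊗ₜ[K] c z) := by
    simp [cTwo, onLast]
  simp only [LinearMap.comp_apply, cTwo_cOne, h'] at h
  exact h.symm

/-- The mirror image, with a letter crossing a relator; here the second bracket identity enters. -/
theorem crossWord_relator (hc : IsBraiding c) (hb : IsBracket c b) (v : V) (z : V ⊗[K] V) :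
    crossWord c (v ⊗ₜ[K] relator c b q z) = LinearMap.rTensor V (relator c b q)
      ((TensorProduct.assoc K V V V).symm (slide c c (v ⊗ₜ[K] z))) := by
  have h : (TensorProduct.assoc K V V V).symm (slide c c (v ⊗ₜ[K] heckeDiff c q z)) =
      LinearMap.rTensor V (heckeDiff c q)
        ((TensorProduct.assoc K V V V).symm (slide c c (v ⊗ₜ[K] z))) := by
    simp only [heckeDiff, LinearMap.sub_apply, LinearMap.smul_apply, LinearMap.id_apply,
      TensorProduct.tmul_sub, map_sub, slide_braid hc, TensorProduct.tmul_smul,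
      map_smul, LinearMap.rTensor_sub, LinearMap.rTensor_smul, LinearMap.rTensor_id]
  have h' : c (v ⊗ₜ[K] b z) = LinearMap.rTensor V b
      ((TensorProduct.assoc K V V V).symm (slide c c (v ⊗ₜ[K] z))) := by
    have h := LinearMap.congr_fun hb.2 ((TensorProduct.assoc K V V V).symm (v ⊗ₜ[K] z))
    simpa only [LinearMap.comp_apply, cTwo_cOne, onFirst, onLast, LinearEquiv.coe_coe,
      LinearEquiv.apply_symm_apply, LinearMap.lTensor_tmul] using h
  rw [relator, LinearMap.sub_apply, LinearMap.comp_apply, LinearMap.comp_apply,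
    TensorProduct.tmul_sub, map_sub, crossWord_twoLetters, h, crossWord_ι, h',
    LinearMap.rTensor_sub, LinearMap.rTensor_comp, LinearMap.rTensor_comp]
  rfl

/-- No closed formula is needed: the first leg consists of relators at the start and, by
`crossWord_relator`, still does after each letter of `x` has crossed. -/
theorem tensorBraiding_relator_right (hc : IsBraiding c) (hb : IsBracket c b)
    (x : TensorAlgebra K V) (z : V ⊗[K] V) : tensorBraiding c (x ⊗ₜ[K] relator c b q z) ∈
      LinearMap.range (LinearMap.rTensor (TensorAlgebra K V) (relator c b q)) := by
  induction x using word_induction_left with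
  | hadd x y hx hy =>
    rw [TensorProduct.add_tmul, map_add]; exact Submodule.add_mem _ hx hy
  | hsmul r x hx =>
    rw [← TensorProduct.smul_tmul', map_smul]; exact Submodule.smul_mem _ r hx
  | hone => exact ⟨z ⊗ₜ[K] 1, by simp [tensorBraiding_one_left]⟩
  | hmul v x hx =>
    obtain ⟨p, hp⟩ := hx
    rw [tensorBraiding_ι_mul, ← hp]
    clear hp
    induction p with
    | zero => simp
    | add x y hx hy => simp only [TensorProduct.tmul_add, map_add]; exact Submodule.add_mem _ hx hy
    | tmul z y =>
      rw [LinearMap.rTensor_tmul, slide_tmul, crossWord_relator hc hb]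
      exact ⟨_, LinearMap.congr_fun ((LinearMap.rTensor_comp_lTensor _ _ _).trans
        (LinearMap.lTensor_comp_rTensor _ _ _).symm) _⟩

/-- The mixed terms come from `v ⊗ u` left in order and from `v` crossing `u`, which together make
`(1 + c) z`. -/
theorem tensorComul_twoLetters (z : V ⊗[K] V) : tensorComul c (twoLetters K V z) =
    twoLetters K V z ⊗ₜ[K] 1 + TensorProduct.map (ι K) (ι K) (z + c z) +
      1 ⊗ₜ[K] twoLetters K V z := by
  induction z with
  | zero => simp
  | add x y hx hy =>
    simp only [map_add, hx, hy, TensorProduct.add_tmul, TensorProduct.tmul_add]; abel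
  | tmul v u =>
    have h : LinearMap.lTensor (TensorAlgebra K V) (appRight letterMul 1)
        (crossWord c (v ⊗ₜ[K] ι K u)) = TensorProduct.map (ι K) (ι K) (c (v ⊗ₜ[K] u)) := by
      rw [crossWord_ι, ← LinearMap.comp_apply, LinearMap.lTensor_comp_rTensor]
      congr 1
      congr 1
      ext; simp
    simp only [twoLetters_tmul, tensorComul_ι_mul, tensorComul_ι, TensorProduct.tmul_add, map_add,
      slide_tmul, h, crossWord_one, smul_add, TensorProduct.smul_tmul', LinearMap.lTensor_tmul,
      appRight_apply, letterMul_tmul, TensorProduct.map_tmul, smul_eq_mul, mul_one]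
    abel

/-- The mixed terms are `(c + 1)(c - q) z`, which the Hecke relation annihilates; the letters `b z`
are primitive anyway. -/
theorem tensorComul_relator (hq : IsHecke c q) (z : V ⊗[K] V) :
    tensorComul c (relator c b q z) = relator c b q z ⊗ₜ[K] 1 + 1 ⊗ₜ[K] relator c b q z := by
  have h : heckeDiff c q z + c (heckeDiff c q z) = 0 := by
    rw [add_comm]; exact LinearMap.congr_fun hq z
  simp only [relator, LinearMap.sub_apply, LinearMap.comp_apply, map_sub, tensorComul_twoLetters,
    h, map_zero, add_zero, tensorComul_ι, TensorProduct.sub_tmul, TensorProduct.tmul_sub]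
  abel

theorem tensorCounit_relator (z : V ⊗[K] V) : (tensorData c).counit (relator c b q z) = 0 := by
  have h : (tensorData c).counit ∘ₗ twoLetters K V = 0 :=
    TensorProduct.ext' fun v u => by simp [tensorCounit_mul]
  have h' := LinearMap.congr_fun h (heckeDiff c q z)
  simp only [LinearMap.comp_apply, LinearMap.zero_apply] at h'
  simp [relator, h']

/-! ### The kernel of the projection and the induced structure -/

theorem proj_surjective : Function.Surjective (proj c b q) :=
  RingQuot.mkAlgHom_surjective K (EnvelopingRel c b q)

theorem proj_relator (z : V ⊗[K] V) : proj c b q (relator c b q z) = 0 := by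
  have h := RingQuot.mkAlgHom_rel K (EnvelopingRel.of (c := c) (b := b) (q := q) z)
  rw [map_zero] at h
  exact h

/-- The kernel of the projection is the smallest ideal that contains the relators. -/
theorem ker_proj_le (N : Submodule K (TensorAlgebra K V))
    (hl : ∀ a x, x ∈ N → a * x ∈ N) (hr : ∀ a x, x ∈ N → x * a ∈ N)
    (hrel : ∀ z, relator c b q z ∈ N) {x : TensorAlgebra K V} (hx : proj c b q x = 0) :
    x ∈ N := by
  have h₁ : ∀ x y, RingQuot.Rel (EnvelopingRel c b q) x y → x - y ∈ N := by
    intro x y h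
    induction h with
    | of h =>
      obtain ⟨z⟩ := h
      rw [sub_zero]
      exact hrel z
    | add_left _ h => rwa [add_sub_add_right_eq_sub]
    | mul_left _ h => rw [← sub_mul]; exact hr _ _ h
    | mul_right _ h => rw [← mul_sub]; exact hl _ _ h
  -- Equality in the quotient is the equivalence relation generated by `RingQuot.Rel`, and
  -- congruence modulo `N` is an equivalence relation.
  have h₂ : ∀ x y, Relation.EqvGen (RingQuot.Rel (EnvelopingRel c b q)) x y → x - y ∈ N := by
    intro x y h
    induction h with
    | rel x y h => exact h₁ x y h
    | refl x => simp
    | symm x y _ h => rw [← neg_sub]; exact N.neg_mem h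
    | trans x y z _ _ h h' => rw [← sub_add_sub_cancel x y z]; exact N.add_mem h h'
  have h : RingQuot.mkRingHom (EnvelopingRel c b q) x =
      RingQuot.mkRingHom (EnvelopingRel c b q) 0 := by
    rw [map_zero, ← RingQuot.mkAlgHom_coe K]
    exact hx
  rw [RingQuot.mkRingHom_def] at h
  have h' : Quot.mk (RingQuot.Rel (EnvelopingRel c b q)) x = Quot.mk _ 0 :=
    congrArg RingQuot.toQuot h
  simpa using h₂ x 0 (Quot.eqvGen_exact h')

/-- The `x` for which this holds with every `y` form a two-sided ideal containing the relators. The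
quantifier over `y` is essential, since for a product the other factor changes `y` before `x` meets
it. -/
theorem lTensor_proj_tensorBraiding (hc : IsBraiding c) (hb : IsBracket c b)
    {x : TensorAlgebra K V} (hx : proj c b q x = 0) (y : TensorAlgebra K V) :
    LinearMap.lTensor _ (proj c b q).toLinearMap (tensorBraiding c (x ⊗ₜ[K] y)) = 0 := by
  set π := (proj c b q).toLinearMap with hπ
  let N : Submodule K (TensorAlgebra K V) :=
    { carrier := {x | ∀ y, LinearMap.lTensor _ π (tensorBraiding c (x ⊗ₜ[K] y)) = 0}
      add_mem' := fun hx hy z => by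
        rw [TensorProduct.add_tmul, map_add, map_add, hx z, hy z, add_zero]
      zero_mem' := fun z => by simp
      smul_mem' := fun r x hx z => by
        rw [← TensorProduct.smul_tmul', map_smul, map_smul, hx z, smul_zero] }
  refine ker_proj_le (c := c) (b := b) (q := q) N ?_ ?_ ?_ hx y
  · intro a x hx y
    have h : π ∘ₗ LinearMap.mul' K (TensorAlgebra K V) =
        (LinearMap.mul' K (Enveloping c b q) ∘ₗ LinearMap.rTensor _ π) ∘ₗ
          LinearMap.lTensor _ π := TensorProduct.ext' fun x y => by simp [hπ]
    rw [tensorBraiding_mul_left, lTensor_slide, h, ← slide_lTensor, hx y,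
      TensorProduct.tmul_zero, map_zero]
  · intro a x hx y
    rw [tensorBraiding_mul_left]
    generalize tensorBraiding c (a ⊗ₜ[K] y) = p
    induction p with
    | zero => simp
    | add p p' hp hp' => simp only [TensorProduct.tmul_add, map_add, hp, hp', add_zero]
    | tmul z a =>
      have h : π ∘ₗ appRight (LinearMap.mul' K (TensorAlgebra K V)) a =
          LinearMap.mulRight K (π a) ∘ₗ π := LinearMap.ext fun x => by simp [hπ]
      rw [slide_tmul, ← LinearMap.comp_apply, ← LinearMap.lTensor_comp, h, LinearMap.lTensor_comp,
        LinearMap.comp_apply, hx z, map_zero]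
  · intro z y
    have h : π ∘ₗ relator c b q = 0 := LinearMap.ext fun z => proj_relator z
    rw [tensorBraiding_relator_left hc hb, ← LinearMap.comp_apply, ← LinearMap.lTensor_comp, h]
    simp

/-- The same argument for the second argument of the braiding; the kernel now appears in the first
leg of the result. -/
theorem rTensor_proj_tensorBraiding (hc : IsBraiding c) (hb : IsBracket c b)
    {y : TensorAlgebra K V} (hy : proj c b q y = 0) (x : TensorAlgebra K V) :
    LinearMap.rTensor _ (proj c b q).toLinearMap (tensorBraiding c (x ⊗ₜ[K] y)) = 0 := by
  set π := (proj c b q).toLinearMap with hπ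
  let N : Submodule K (TensorAlgebra K V) :=
    { carrier := {y | ∀ x, LinearMap.rTensor _ π (tensorBraiding c (x ⊗ₜ[K] y)) = 0}
      add_mem' := fun hx hy z => by
        rw [TensorProduct.tmul_add, map_add, map_add, hx z, hy z, add_zero]
      zero_mem' := fun z => by simp
      smul_mem' := fun r x hx z => by
        rw [TensorProduct.tmul_smul, map_smul, map_smul, hx z, smul_zero] }
  have hs : ∀ (a : TensorAlgebra K V) (u : TensorAlgebra K V ⊗[K] TensorAlgebra K V),
      LinearMap.rTensor _ π (a • u) = π a • LinearMap.rTensor _ π u := by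
    intro a u
    induction u with
    | zero => simp
    | add u v hu hv => simp only [smul_add, map_add, hu, hv]
    | tmul x y => simp [hπ, TensorProduct.smul_tmul']
  refine ker_proj_le (c := c) (b := b) (q := q) N ?_ ?_ ?_ hy x
  · intro a y hy x
    rw [(isRightCross_tensorBraiding c).mul]
    generalize tensorBraiding c (x ⊗ₜ[K] a) = p
    induction p with
    | zero => simp
    | add p p' hp hp' => simp only [map_add, hp, hp', add_zero]
    | tmul a x => rw [moveL_tmul, hs, hy x, smul_zero]
  · intro a y hy x
    have h : ∀ u, LinearMap.rTensor _ π (moveL (tensorBraiding c) a u) =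
        linExt (LinearMap.rTensor _ π ∘ₗ appRight (tensorBraiding c) a)
          (LinearMap.rTensor _ π u) := by
      intro u
      induction u with
      | zero => simp
      | add u v hu hv => simp only [map_add, hu, hv]
      | tmul x y => simp [hs]
    rw [(isRightCross_tensorBraiding c).mul, h, hy x, map_zero]
  · intro z x
    obtain ⟨p, hp⟩ := tensorBraiding_relator_right (q := q) hc hb x z
    have h : π ∘ₗ relator c b q = 0 := LinearMap.ext fun z => proj_relator z
    rw [← hp, ← LinearMap.comp_apply, ← LinearMap.rTensor_comp, h]
    simp

theorem proj_representative (u : Enveloping c b q) :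
    proj c b q (representative c b q u) = u :=
  LinearMap.congr_fun (exists_section c b q).choose_spec u

theorem proj_representative_sub (x : TensorAlgebra K V) :
    proj c b q (representative c b q (proj c b q x) - x) = 0 := by
  rw [map_sub, proj_representative, sub_self]

/-- Chosen representatives differ from `x` and `y` by elements of the kernel. They are replaced one
argument at a time: `π` on the second leg removes the first error, `π` on the first leg removes the
second. -/
theorem isBraidedHom_proj (hc : IsBraiding c) (hb : IsBracket c b) :
    IsBraidedHom (tensorData c).braiding (envelopingData c b q).braiding
      (proj c b q).toLinearMap := by
  refine TensorProduct.ext' fun x y => ?_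
  set π := (proj c b q).toLinearMap with hπ
  set x' := representative c b q (proj c b q x) with hx'
  set y' := representative c b q (proj c b q y) with hy'
  have h₁ : TensorProduct.map π π (tensorBraiding c ((x' - x) ⊗ₜ[K] y')) = 0 := by
    rw [← LinearMap.rTensor_comp_lTensor, LinearMap.comp_apply,
      lTensor_proj_tensorBraiding hc hb (proj_representative_sub x), map_zero]
  have h₂ : TensorProduct.map π π (tensorBraiding c (x ⊗ₜ[K] (y' - y))) = 0 := by
    rw [← LinearMap.lTensor_comp_rTensor, LinearMap.comp_apply,
      rTensor_proj_tensorBraiding hc hb (proj_representative_sub y), map_zero]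
  rw [TensorProduct.sub_tmul, map_sub, map_sub, sub_eq_zero] at h₁
  rw [TensorProduct.tmul_sub, map_sub, map_sub, sub_eq_zero] at h₂
  exact h₁.trans h₂

/-- As `π` respects the braidings, `(π ⊗ π) Δ` is multiplicative and its kernel is an ideal; it
contains the relators because they are primitive. -/
theorem map_proj_tensorComul (hc : IsBraiding c) (hq : IsHecke c q) (hb : IsBracket c b)
    {x : TensorAlgebra K V} (hx : proj c b q x = 0) :
    TensorProduct.map (proj c b q).toLinearMap (proj c b q).toLinearMap (tensorComul c x) = 0 := by
  have hp := isBraidedHom_proj (q := q) hc hb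
  have hm : ∀ u v, TensorProduct.map (proj c b q).toLinearMap (proj c b q).toLinearMap
      (braidedMul (tensorBraiding c) u v) = _ := map_braidedMul (proj c b q) hp
  refine ker_proj_le (c := c) (b := b) (q := q) (LinearMap.ker
    (TensorProduct.map (proj c b q).toLinearMap (proj c b q).toLinearMap ∘ₗ tensorComul c))
    ?_ ?_ ?_ hx
  · intro a x hx
    rw [LinearMap.mem_ker, LinearMap.comp_apply] at hx ⊢
    rw [tensorComul_mul, hm, hx, map_zero]
  · intro a x hx
    rw [LinearMap.mem_ker, LinearMap.comp_apply] at hx ⊢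
    rw [tensorComul_mul, hm, hx, map_zero, LinearMap.zero_apply]
  · intro z
    rw [LinearMap.mem_ker, LinearMap.comp_apply, tensorComul_relator hq, map_add,
      TensorProduct.map_tmul, TensorProduct.map_tmul, AlgHom.toLinearMap_apply, proj_relator]
    simp

theorem tensorCounit_of_proj_eq_zero {x : TensorAlgebra K V} (hx : proj c b q x = 0) :
    (tensorData c).counit x = 0 := by
  refine ker_proj_le (c := c) (b := b) (q := q) (LinearMap.ker (tensorData c).counit) ?_ ?_ ?_ hx
  · intro a x hx
    rw [LinearMap.mem_ker] at hx ⊢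
    rw [tensorCounit_mul, hx, mul_zero]
  · intro a x hx
    rw [LinearMap.mem_ker] at hx ⊢
    rw [tensorCounit_mul, hx, zero_mul]
  · exact tensorCounit_relator

theorem isBialgebraHom_proj (hc : IsBraiding c) (hq : IsHecke c q) (hb : IsBracket c b) :
    IsBialgebraHom (tensorData c) (envelopingData c b q) (proj c b q) where
  braiding := isBraidedHom_proj hc hb
  comul := by
    refine LinearMap.ext fun x => ?_
    have h := map_proj_tensorComul hc hq hb (proj_representative_sub (c := c) (b := b) (q := q) x)
    rw [map_sub, map_sub, sub_eq_zero] at h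
    exact h
  counit := by
    refine LinearMap.ext fun x => ?_
    have h := tensorCounit_of_proj_eq_zero (proj_representative_sub (c := c) (b := b) (q := q) x)
    rw [map_sub, sub_eq_zero] at h
    exact h

theorem isBraidedBialgebra_envelopingData (hc : IsBraiding c) (hq : IsHecke c q)
    (hb : IsBracket c b) : IsBraidedBialgebra (envelopingData c b q) :=
  (isBraidedBialgebra_tensorData hc).of_surjective (proj c b q) (isBialgebraHom_proj hc hq hb)
    proj_surjective

end EnvelopingStructure

/-! ### Brackets of mark different from `0` and `1` -/

section BracketVanishing

variable {K : Type*} [Field K] {P : Type*} [AddCommGroup P] [Module K P]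
variable {c : P ⊗[K] P →ₗ[K] P ⊗[K] P} {b : P ⊗[K] P →ₗ[K] P} {q : K}

theorem IsHecke.apply_apply (h : IsHecke c q) (z : P ⊗[K] P) :
    c (c z) = (q - 1) • c z + q • z := by
  have h := LinearMap.congr_fun h z
  simp only [heckeDiff, LinearMap.comp_apply, LinearMap.add_apply, LinearMap.sub_apply,
    LinearMap.smul_apply, LinearMap.id_apply, map_sub, map_smul, LinearMap.zero_apply] at h
  rw [← sub_eq_zero, ← h]
  module

theorem IsHecke.heckeDiff_add (h : IsHecke c q) (z : P ⊗[K] P) :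
    heckeDiff c q (c z) + heckeDiff c q z = 0 := by
  simp only [heckeDiff, LinearMap.sub_apply, LinearMap.smul_apply, LinearMap.id_apply,
    h.apply_apply]
  module

theorem IsBraidedHom.map_heckeDiff {W : Type*} [AddCommGroup W] [Module K W]
    {c' : W ⊗[K] W →ₗ[K] W ⊗[K] W} {f : P →ₗ[K] W} (hf : IsBraidedHom c c' f) (q : K)
    (z : P ⊗[K] P) : TensorProduct.map f f (heckeDiff c q z) =
      heckeDiff c' q (TensorProduct.map f f z) := by
  have h := LinearMap.congr_fun hf z
  simp only [LinearMap.comp_apply] at h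
  simp only [heckeDiff, LinearMap.sub_apply, LinearMap.smul_apply, LinearMap.id_apply, map_sub,
    map_smul, h]

theorem IsHecke.cOne_cOne (h : IsHecke c q) (u : (P ⊗[K] P) ⊗[K] P) :
    cOne c (cOne c u) = (q - 1) • cOne c u + q • u := by
  have e : c ∘ₗ c = (q - 1) • c + q • LinearMap.id := LinearMap.ext h.apply_apply
  rw [cOne, onFirst, ← LinearMap.comp_apply, ← LinearMap.rTensor_comp, e]
  simp [LinearMap.rTensor_add, LinearMap.rTensor_smul]

theorem IsHecke.cTwo_cTwo (h : IsHecke c q) (u : (P ⊗[K] P) ⊗[K] P) :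
    cTwo c (cTwo c u) = (q - 1) • cTwo c u + q • u := by
  have e : c ∘ₗ c = (q - 1) • c + q • LinearMap.id := LinearMap.ext h.apply_apply
  apply (TensorProduct.assoc K P P P).injective
  simp only [cTwo, onLast, LinearMap.comp_apply, LinearEquiv.coe_coe,
    LinearEquiv.apply_symm_apply, map_add, map_smul]
  rw [← LinearMap.comp_apply, ← LinearMap.lTensor_comp, e]
  simp [LinearMap.lTensor_add, LinearMap.lTensor_smul]

/-- A bracket that is antisymmetric with respect to `c` satisfies `b₂ = -b₁`. -/
theorem onLast_eq_neg_onFirst (hc : IsBraiding c) (hq : IsHecke c q) (hb : IsBracket c b)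
    (hanti : ∀ z, b (c z) = -b z) (hq0 : q ≠ 0) (hq1 : q ≠ 1) (hq3 : 1 + q + q ^ 2 ≠ 0)
    (u : (P ⊗[K] P) ⊗[K] P) : onLast b u = -onFirst b u := by
  have H₁ : ∀ u, c (onFirst b u) = onLast b (cOne c (cTwo c u)) := LinearMap.congr_fun hb.1
  have H₂ : ∀ u, c (onLast b u) = onFirst b (cTwo c (cOne c u)) := LinearMap.congr_fun hb.2
  have B : ∀ u, cOne c (cTwo c (cOne c u)) = cTwo c (cOne c (cTwo c u)) := LinearMap.congr_fun hc
  have e : b ∘ₗ c = -b := LinearMap.ext hanti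
  have N₁ : ∀ u, onFirst b (cOne c u) = -onFirst b u := by
    intro u
    rw [cOne, onFirst, onFirst, ← LinearMap.comp_apply, ← LinearMap.rTensor_comp, e,
      LinearMap.rTensor_neg, LinearMap.neg_apply]
  have N₂ : ∀ u, onLast b (cTwo c u) = -onLast b u := by
    intro u
    simp only [cTwo, onLast, LinearMap.comp_apply, LinearEquiv.coe_coe,
      LinearEquiv.apply_symm_apply]
    rw [← LinearMap.comp_apply, ← LinearMap.lTensor_comp, e, LinearMap.lTensor_neg,
      LinearMap.neg_apply]
  have hq1' : q - 1 ≠ 0 := sub_ne_zero.2 hq1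
  -- Two computations of `c²b₁`: the Hecke relation gives `(q - 1) cb₁ + q b₁`, the bracket
  -- identities give `b₁c₂c₁c₁c₂`. Reduce the latter by Hecke, braid and `b₁c₁ = -b₁`, then divide
  -- by `q - 1`. `E₂` is the same with the indices 1 and 2 exchanged.
  have E₁ : ∀ u, onLast b (cOne c (cTwo c u)) + onFirst b (cTwo c (cOne c u)) =
      q • (onFirst b (cTwo c u) + onFirst b u) := by
    intro u
    have h : c (c (onFirst b u)) = _ := hq.apply_apply (onFirst b u)
    rw [H₁, H₂, hq.cOne_cOne, map_add, map_smul, map_smul, hq.cTwo_cTwo, map_add, map_smul,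
      map_smul, ← B, N₁, map_add, map_smul, map_smul] at h
    refine smul_right_injective _ hq1' (?_ : (q - 1) • _ = (q - 1) • _)
    linear_combination (norm := module) -h
  have E₂ : ∀ u, onFirst b (cTwo c (cOne c u)) + onLast b (cOne c (cTwo c u)) =
      q • (onLast b (cOne c u) + onLast b u) := by
    intro u
    have h : c (c (onLast b u)) = _ := hq.apply_apply (onLast b u)
    rw [H₂, H₁, hq.cTwo_cTwo, map_add, map_smul, map_smul, hq.cOne_cOne, map_add, map_smul,
      map_smul, B, N₂, map_add, map_smul, map_smul] at h
    refine smul_right_injective _ hq1' (?_ : (q - 1) • _ = (q - 1) • _)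
    linear_combination (norm := module) -h
  -- The left sides of `E₁` and `E₂` agree, so their right sides do; cancel `q`.
  have E₃ : ∀ u, onLast b (cOne c u) + onLast b u = onFirst b (cTwo c u) + onFirst b u := by
    intro u
    refine smul_right_injective _ hq0 (?_ : q • _ = q • _)
    rw [← E₁, ← E₂, add_comm]
  -- `E₃` composed with `c₂`, with `E₃` itself used to eliminate `b₁`.
  have E₄ : ∀ u, onLast b (cOne c (cTwo c u)) =
      onLast b u + q • (onLast b (cOne c u) + onLast b u) := by
    intro u
    have h := E₃ (cTwo c u)
    rw [N₂, hq.cTwo_cTwo, map_add, map_smul, map_smul] at h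
    have h' := E₃ u
    linear_combination (norm := module) h - q • h'
  -- Put `X = b₂c₁ + b₂`. Composing `E₄` with `c₁`, and using `b₂c₁c₂c₁ = b₂c₂c₁c₂ = -b₂c₁c₂`, gives
  -- `-(b₂ + qX) = b₂c₁ + q²X`, that is `(1 + q + q²) X = 0`.
  have E₅ : ∀ u, onLast b (cOne c u) = -onLast b u := by
    intro u
    have h := E₄ (cOne c u)
    rw [B, N₂, E₄, hq.cOne_cOne, map_add, map_smul, map_smul] at h
    have h' : (1 + q + q ^ 2) • (onLast b (cOne c u) + onLast b u) = 0 := by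
      linear_combination (norm := module) -h
    exact eq_neg_of_add_eq_zero_left ((smul_eq_zero.1 h').resolve_left hq3)
  -- Now `b₁c₂ = -b₁` as well, so `b₁c₂c₁ = b₁` and `b₂c₁c₂ = b₂`, and `E₁` reads `b₂ + b₁ = 0`.
  have h := E₃ u
  have h' := E₃ (cOne c u)
  have h'' := E₁ u
  rw [E₅] at h
  rw [E₅, N₁] at h'
  rw [E₅, N₂, neg_neg] at h''
  linear_combination (norm := module) h'' + h' - q • h

/-- `x ⊗ [y, z] = -[x, y] ⊗ z` forces the bracket to vanish. -/
theorem eq_zero_of_onLast_eq_neg_onFirst (hchar : ringChar K ≠ 2)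
    (h : ∀ u, onLast b u = -onFirst b u) : b = 0 := by
  have h' : ∀ x y z, x ⊗ₜ[K] b (y ⊗ₜ[K] z) = -(b (x ⊗ₜ[K] y) ⊗ₜ[K] z) := by
    intro x y z
    simpa [onLast, onFirst] using h ((x ⊗ₜ[K] y) ⊗ₜ[K] z)
  -- Contract the second tensor factor with `φ`.
  have h₂ : ∀ (φ : P →ₗ[K] K) x y z, φ (b (y ⊗ₜ[K] z)) • x = -(φ z • b (x ⊗ₜ[K] y)) := by
    intro φ x y z
    have := congrArg (TensorProduct.rid K P ∘ LinearMap.lTensor P φ) (h' x y z)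
    simpa using this
  refine TensorProduct.ext' fun y z => ?_
  by_contra hw
  rw [LinearMap.zero_apply] at hw
  have hy : y ≠ 0 := by rintro rfl; simp at hw
  obtain ⟨φ, hφ⟩ : ∃ φ : Module.Dual K P, φ (b (y ⊗ₜ[K] z)) ≠ 0 := by
    by_contra! hφ
    exact hw ((Module.forall_dual_apply_eq_zero_iff K _).1 hφ)
  obtain ⟨ψ, hψ⟩ : ∃ ψ : Module.Dual K P, ψ y ≠ 0 := by
    by_contra! hψ
    exact hy ((Module.forall_dual_apply_eq_zero_iff K _).1 hψ)
  -- With `ψ` and `x = y = z` the identity gives `2 ψ(y) ψ([y, y]) = 0`, so `ψ([y, y]) = 0` as `2 ≠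
  -- 0`. With `φ` and `x = y`, applying `ψ` then gives `φ([y, z]) ψ(y) = 0`, against the choice of
  -- `φ` and `ψ`.
  have e := h₂ φ y y z
  have e' := congrArg ψ (h₂ ψ y y y)
  have e'' := congrArg ψ e
  simp only [map_smul, map_neg, smul_eq_mul] at e' e''
  have h2 : (2 : K) ≠ 0 := Ring.two_ne_zero hchar
  have e₃ : ψ (b (y ⊗ₜ[K] y)) = 0 := by
    have : 2 * ψ y * ψ (b (y ⊗ₜ[K] y)) = 0 := by linear_combination e'
    exact (mul_eq_zero.1 this).resolve_left (mul_ne_zero h2 hψ)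
  rw [e₃, mul_zero, neg_zero] at e''
  exact (mul_ne_zero hφ hψ) e''

end BracketVanishing

/-! ### The infinitesimal braiding and the canonical bracket -/

section Canonical

variable {K : Type*} [Field K] {A : Type*} [Ring A] [Algebra K A]
variable {S : BialgebraData K A} (hS : IsBraidedBialgebra S) {q : K}

theorem isBraidedHom_primBraiding :
    IsBraidedHom (primBraiding S hS) S.braiding (primitives S).subtype :=
  LinearMap.ext fun z => (inclSq_primBraiding S hS z).symm

theorem inclCube_injective (S : BialgebraData K A) :
    Function.Injective (TensorProduct.map (inclSq S) (primitives S).subtype) :=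
  TensorProduct.map_injective_of_flat_flat _ _ (inclSq_injective S)
    (primitives S).injective_subtype

theorem isBraiding_primBraiding : IsBraiding (primBraiding S hS) := by
  refine LinearMap.ext fun u => inclCube_injective S ?_
  have h₁ : ∀ u, TensorProduct.map (inclSq S) (primitives S).subtype
      (cOne (primBraiding S hS) u) = _ := fun u => (cOne_map (isBraidedHom_primBraiding hS) u).symm
  have h₂ : ∀ u, TensorProduct.map (inclSq S) (primitives S).subtype
      (cTwo (primBraiding S hS) u) = _ := fun u => (cTwo_map (isBraidedHom_primBraiding hS) u).symm
  simp only [LinearMap.comp_apply]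
  erw [h₁, h₂, h₁, h₂, h₁, h₂]
  exact LinearMap.congr_fun hS.algebra.braid _

theorem onFirst_comp_heckeDiff {V W : Type*} [AddCommGroup V] [Module K V] [AddCommGroup W]
    [Module K W] (c : V ⊗[K] V →ₗ[K] V ⊗[K] V) (m : V ⊗[K] V →ₗ[K] W)
    (u : (V ⊗[K] V) ⊗[K] V) :
    onFirst (m ∘ₗ heckeDiff c q) u = onFirst m (cOne c u) - q • onFirst m u := by
  simp [onFirst, cOne, heckeDiff, LinearMap.rTensor_comp, LinearMap.rTensor_sub,
    LinearMap.rTensor_smul]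

theorem onLast_comp_heckeDiff {V W : Type*} [AddCommGroup V] [Module K V] [AddCommGroup W]
    [Module K W] (c : V ⊗[K] V →ₗ[K] V ⊗[K] V) (m : V ⊗[K] V →ₗ[K] W)
    (u : (V ⊗[K] V) ⊗[K] V) :
    onLast (m ∘ₗ heckeDiff c q) u = onLast m (cTwo c u) - q • onLast m u := by
  simp [onLast, cTwo, heckeDiff, LinearMap.lTensor_comp, LinearMap.lTensor_sub,
    LinearMap.lTensor_smul]

/-- The braid equation lets `c - q` pass from position 1 to position 2 and back, so `∇(c - q)`
satisfies the bracket identities on the whole of `A` because `∇` does. -/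
theorem CommutesWith.comp_heckeDiff {V : Type*} [AddCommGroup V] [Module K V]
    {c : V ⊗[K] V →ₗ[K] V ⊗[K] V} {m : V ⊗[K] V →ₗ[K] V} (hc : IsBraiding c)
    (hm : CommutesWith c m) (q : K) : CommutesWith c (m ∘ₗ heckeDiff c q) := by
  have B : ∀ u, cOne c (cTwo c (cOne c u)) = cTwo c (cOne c (cTwo c u)) := LinearMap.congr_fun hc
  have H₁ : ∀ u, c (onFirst m u) = onLast m (cOne c (cTwo c u)) := LinearMap.congr_fun hm.1
  have H₂ : ∀ u, c (onLast m u) = onFirst m (cTwo c (cOne c u)) := LinearMap.congr_fun hm.2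
  refine ⟨LinearMap.ext fun u => ?_, LinearMap.ext fun u => ?_⟩
  · simp only [LinearMap.comp_apply, onFirst_comp_heckeDiff, onLast_comp_heckeDiff, map_sub,
      map_smul, H₁, B]
  · simp only [LinearMap.comp_apply, onFirst_comp_heckeDiff, onLast_comp_heckeDiff, map_sub,
      map_smul, H₂, B]

theorem subtype_canonicalBracket (hq : IsHecke (primBraiding S hS) q) :
    (LinearMap.mul' K A ∘ₗ heckeDiff S.braiding q) ∘ₗ
        TensorProduct.map (primitives S).subtype (primitives S).subtype =
      (primitives S).subtype ∘ₗ canonicalBracket S hS q hq := by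
  refine LinearMap.ext fun z => ?_
  exact congrArg (LinearMap.mul' K A)
    ((isBraidedHom_primBraiding hS).map_heckeDiff q z).symm

/-- The identities hold for `∇(c_A - q)` on `A`, and they restrict to `P` because `P ⊗ P → A ⊗ A` is
injective. -/
theorem isBracket_canonicalBracket (hq : IsHecke (primBraiding S hS) q) :
    IsBracket (primBraiding S hS) (canonicalBracket S hS q hq) := by
  have hβ := hS.algebra.mul.comp_heckeDiff hS.algebra.braid q
  have H := subtype_canonicalBracket hS hq
  have hP := isBraidedHom_primBraiding hS
  refine ⟨LinearMap.ext fun u => inclSq_injective S ?_,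
    LinearMap.ext fun u => inclSq_injective S ?_⟩
  · rw [LinearMap.comp_apply, inclSq_primBraiding]
    simp only [LinearMap.comp_apply, inclSq, ← onFirst_map H, ← onLast_map H, ← cOne_map hP,
      ← cTwo_map hP]
    exact LinearMap.congr_fun hβ.1 _
  · rw [LinearMap.comp_apply, inclSq_primBraiding]
    simp only [LinearMap.comp_apply, inclSq, ← onFirst_map H, ← onLast_map H, ← cOne_map hP,
      ← cTwo_map hP]
    exact LinearMap.congr_fun hβ.2 _

theorem canonicalBracket_braiding (hq : IsHecke (primBraiding S hS) q)
    (z : primitives S ⊗[K] primitives S) :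
    canonicalBracket S hS q hq (primBraiding S hS z) = -canonicalBracket S hS q hq z := by
  apply Subtype.ext
  refine eq_neg_of_add_eq_zero_left ?_
  have h := congrArg (LinearMap.mul' K A ∘ inclSq S) (hq.heckeDiff_add z)
  simp only [Function.comp_apply, map_add, map_zero] at h
  exact h

theorem canonicalBracket_eq_zero (hchar : ringChar K ≠ 2) (hq0 : q ≠ 0) (hq1 : q ≠ 1)
    (hq3 : qFactorial 3 q ≠ 0) (hq : IsHecke (primBraiding S hS) q) :
    canonicalBracket S hS q hq = 0 := by
  have h3 : 1 + q + q ^ 2 ≠ 0 := by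
    intro h
    apply hq3
    simp [qFactorial, qNumber, Finset.prod_range_succ, Finset.sum_range_succ, h]
  exact eq_zero_of_onLast_eq_neg_onFirst hchar
    (onLast_eq_neg_onFirst (isBraiding_primBraiding hS) hq (isBracket_canonicalBracket hS hq)
      (canonicalBracket_braiding hS hq) hq0 hq1 h3)

end Canonical

/-! ### Lifting to the tensor algebra and to the enveloping algebra -/

section Lifting

open TensorAlgebra (ι)

variable {K : Type*} [Field K] {A : Type*} [Ring A] [Algebra K A]
variable {V : Type*} [AddCommGroup V] [Module K V]
variable {c : V ⊗[K] V →ₗ[K] V ⊗[K] V} {c' : A ⊗[K] A →ₗ[K] A ⊗[K] A} {f : V →ₗ[K] A}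

/-- Append one letter at a time: in `A` a product is crossed factor by factor, the recursion that
defines `crossWord`. `isBraidedHom_lift` does the same for the left argument. -/
theorem braiding_lift_word (hA : IsBraidedAlgebra c') (hf : IsBraidedHom c c' f) (v : V)
    (y : TensorAlgebra K V) : c' (f v ⊗ₜ[K] TensorAlgebra.lift K f y) =
      TensorProduct.map (TensorAlgebra.lift K f).toLinearMap f (crossWord c (v ⊗ₜ[K] y)) := by
  induction y using word_induction_right with
  | hadd x y hx hy => simp only [TensorProduct.tmul_add, map_add, hx, hy]
  | hsmul r x hx => simp only [TensorProduct.tmul_smul, map_smul, hx]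
  | hone => simp [crossWord_one, hA.one_right]
  | hmul w y hy =>
    rw [map_mul, TensorAlgebra.lift_ι_apply, hA.isRightCross.mul, hy, crossWord_mul_ι]
    generalize crossWord c (v ⊗ₜ[K] y) = p
    induction p with
    | zero => simp
    | add p p' hp hp' => simp only [map_add, hp, hp']
    | tmul y v =>
      have h := LinearMap.congr_fun hf (v ⊗ₜ[K] w)
      simp only [LinearMap.comp_apply, TensorProduct.map_tmul] at h
      rw [crossStepRight_tmul, TensorProduct.map_tmul, moveL_tmul, h]
      generalize c (v ⊗ₜ[K] w) = p
      induction p with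
      | zero => simp
      | add p p' hp hp' => simp only [map_add, smul_add, hp, hp']
      | tmul a b => simp [TensorProduct.smul_tmul']

theorem isBraidedHom_lift (hA : IsBraidedAlgebra c') (hf : IsBraidedHom c c' f) :
    IsBraidedHom (tensorBraiding c) c' (TensorAlgebra.lift K f).toLinearMap := by
  refine TensorProduct.ext' fun x y => ?_
  simp only [LinearMap.comp_apply, TensorProduct.map_tmul, AlgHom.toLinearMap_apply]
  induction x using word_induction_left with
  | hadd x y hx hy => simp only [TensorProduct.add_tmul, map_add, hx, hy]
  | hsmul r x hx => simp only [← TensorProduct.smul_tmul', map_smul, hx]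
  | hone => simp [tensorBraiding_one_left, hA.one_left]
  | hmul v x hx =>
    rw [map_mul, TensorAlgebra.lift_ι_apply, hA.mul_left, hx, tensorBraiding_ι_mul]
    generalize tensorBraiding c (x ⊗ₜ[K] y) = p
    induction p with
    | zero => simp
    | add p p' hp hp' => simp only [TensorProduct.tmul_add, map_add, hp, hp']
    | tmul y x =>
      rw [TensorProduct.map_tmul, slide_tmul, slide_tmul, AlgHom.toLinearMap_apply,
        AlgHom.toLinearMap_apply, braiding_lift_word hA hf]
      generalize crossWord c (v ⊗ₜ[K] y) = p
      induction p with
      | zero => simp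
      | add p p' hp hp' => simp only [map_add, hp, hp']
      | tmul a b => simp

/-- Applying `ε ⊗ ε` to `Δ x = x ⊗ 1 + 1 ⊗ x` gives `ε(x) = 2 ε(x)`. -/
theorem counit_of_mem_primitives {S : BialgebraData K A} (hS : IsBraidedBialgebra S) {x : A}
    (hx : x ∈ primitives S) : S.counit x = 0 := by
  have h := congrArg (S.counit ∘ TensorProduct.lid K A) (hS.coalgebra.counit_left x)
  rw [mem_primitives] at hx
  simpa [hx, hS.counit_one] using h

/-- A braided map from `V` to the primitive elements extends to `T(V, c)`. -/
theorem isBialgebraHom_lift {S : BialgebraData K A} (hS : IsBraidedBialgebra S)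
    (hf : IsBraidedHom c S.braiding f) (hfP : ∀ v, f v ∈ primitives S) :
    IsBialgebraHom (tensorData c) S (TensorAlgebra.lift K f) where
  braiding := isBraidedHom_lift hS.algebra hf
  comul := by
    refine LinearMap.ext fun x => ?_
    change S.comul (TensorAlgebra.lift K f x) = TensorProduct.map _ _ (tensorComul c x)
    induction x using word_induction_right with
    | hadd x y hx hy => simp only [map_add, hx, hy]
    | hsmul r x hx => simp only [map_smul, hx]
    | hone => simp [tensorComul_one, hS.comul_one]
    | hmul v x hx =>
      rw [map_mul, hS.comul_mul, hx, tensorComul_mul_ι,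
        map_braidedMul _ (isBraidedHom_lift hS.algebra hf), TensorAlgebra.lift_ι_apply,
        (mem_primitives S _).1 (hfP v)]
      simp
  counit := by
    refine LinearMap.ext fun x => ?_
    change S.counit (TensorAlgebra.lift K f x) = (tensorData c).counit x
    induction x using word_induction_right with
    | hadd x y hx hy => simp only [map_add, hx, hy]
    | hsmul r x hx => simp only [map_smul, hx]
    | hone => rw [map_one, hS.counit_one, tensorCounit_one]
    | hmul v x hx =>
      rw [map_mul, hS.counit_mul, TensorAlgebra.lift_ι_apply, counit_of_mem_primitives hS (hfP v),
        tensorCounit_mul, tensorCounit_ι, mul_zero, mul_zero]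

/-- Since `f` is braided, `(c - q) z` is sent to `∇(c_P - q)(f ⊗ f) z`, the canonical bracket of `(f
⊗ f) z`; and this is `f (b z)` because `f` respects brackets. -/
theorem lift_relator {S : BialgebraData K A} (hS : IsBraidedBialgebra S) {q : K}
    (hq : IsHecke (primBraiding S hS) q) {b : V ⊗[K] V →ₗ[K] V} {f : V →ₗ[K] primitives S}
    (hf : IsBracketHom c b (primBraiding S hS) (canonicalBracket S hS q hq) f) (z : V ⊗[K] V) :
    TensorAlgebra.lift K ((primitives S).subtype ∘ₗ f) (relator c b q z) = 0 := by
  have h₁ : ∀ z, TensorAlgebra.lift K ((primitives S).subtype ∘ₗ f) (twoLetters K V z) =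
      LinearMap.mul' K A (inclSq S (TensorProduct.map f f z)) := by
    intro z
    induction z with
    | zero => simp
    | add x y hx hy => simp only [map_add, hx, hy]
    | tmul v w => simp [inclSq]
  have h₂ : TensorProduct.map f f (heckeDiff c q z) =
      heckeDiff (primBraiding S hS) q (TensorProduct.map f f z) :=
    IsBraidedHom.map_heckeDiff hf.1 q z
  have h₃ := congrArg Subtype.val (LinearMap.congr_fun hf.2 z)
  rw [relator, LinearMap.sub_apply, LinearMap.comp_apply, LinearMap.comp_apply, map_sub, h₁, h₂,
    TensorAlgebra.lift_ι_apply, sub_eq_zero]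
  exact h₃.symm

theorem isBraidedHom_subtype_comp {S : BialgebraData K A} (hS : IsBraidedBialgebra S)
    {f : V →ₗ[K] primitives S} (hf : IsBraidedHom c (primBraiding S hS) f) :
    IsBraidedHom c S.braiding ((primitives S).subtype ∘ₗ f) := by
  refine LinearMap.ext fun z => ?_
  have h := LinearMap.congr_fun (isBraidedHom_primBraiding hS) (TensorProduct.map f f z)
  have h' := LinearMap.congr_fun hf z
  simp only [LinearMap.comp_apply] at h h'
  simp only [LinearMap.comp_apply, TensorProduct.map_comp]
  rw [h, h']

/-- The universal property of the enveloping algebra. -/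
theorem existsUnique_lift {S : BialgebraData K A} (hS : IsBraidedBialgebra S) {q : K}
    (hq : IsHecke (primBraiding S hS) q) {b : V ⊗[K] V →ₗ[K] V}
    (hc : IsBraiding c) (hqc : IsHecke c q) (hb : IsBracket c b) {f : V →ₗ[K] primitives S}
    (hf : IsBracketHom c b (primBraiding S hS) (canonicalBracket S hS q hq) f) :
    ∃! g : Enveloping c b q →ₐ[K] A,
      IsBialgebraHom (envelopingData c b q) S g ∧ ∀ v : V, g (envelopingι c b q v) = f v := by
  have hrel : ∀ ⦃x y : TensorAlgebra K V⦄, EnvelopingRel c b q x y →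
      TensorAlgebra.lift K ((primitives S).subtype ∘ₗ f) x =
        TensorAlgebra.lift K ((primitives S).subtype ∘ₗ f) y := by
    rintro _ _ ⟨z⟩
    rw [map_zero]
    exact lift_relator hS hq hf z
  have hcomp : (RingQuot.liftAlgHom K ⟨_, hrel⟩).comp (proj c b q) =
      TensorAlgebra.lift K ((primitives S).subtype ∘ₗ f) :=
    AlgHom.ext fun x => RingQuot.liftAlgHom_mkAlgHom_apply K _ hrel x
  refine ⟨RingQuot.liftAlgHom K ⟨_, hrel⟩, ⟨?_, fun v => ?_⟩, fun g hg => ?_⟩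
  · refine (isBialgebraHom_proj hc hqc hb).of_comp proj_surjective ?_
    rw [hcomp]
    exact isBialgebraHom_lift hS (isBraidedHom_subtype_comp hS hf.1) fun v => (f v).2
  · have h := AlgHom.congr_fun hcomp (ι K v)
    rw [TensorAlgebra.lift_ι_apply] at h
    exact h
  · refine RingQuot.ringQuot_ext' K _ _ ?_
    change g.comp (proj c b q) = (RingQuot.liftAlgHom K ⟨_, hrel⟩).comp (proj c b q)
    rw [hcomp]
    refine TensorAlgebra.hom_ext (LinearMap.ext fun v => ?_)
    simpa [envelopingι] using hg.2 v

end Lifting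

end Braided

end

theorem mainTheorem6 {K : Type*} [Field K] (hchar : ringChar K ≠ 2)
    {A : Type*} [Ring A] [Algebra K A]
    (S : Braided.BialgebraData K A) (hS : Braided.IsBraidedBialgebra S)
    (hconn : Braided.IsConnected S.comul)
    (q : K) (hq0 : q ≠ 0) (hq1 : q ≠ 1) (hq3 : Braided.qFactorial 3 q ≠ 0)
    (hHecke : Braided.IsHecke (Braided.primBraiding S hS) q) :
    Braided.canonicalBracket S hS q hHecke = 0 ∧
    ∀ {V : Type*} [AddCommGroup V] [Module K V]
      (c : V ⊗[K] V →ₗ[K] V ⊗[K] V) (b : V ⊗[K] V →ₗ[K] V),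
      Braided.IsBraiding c → Braided.IsHecke c q → Braided.IsBracket c b →
      Braided.IsBraidedBialgebra (Braided.envelopingData c b q) ∧
      Braided.IsBialgebraHom (Braided.tensorData c) (Braided.envelopingData c b q)
        (Braided.proj c b q) ∧
      ∀ f : V →ₗ[K] Braided.primitives S,
        Braided.IsBracketHom c b (Braided.primBraiding S hS) 0 f →
        ∃! g : Braided.Enveloping c b q →ₐ[K] A,
          Braided.IsBialgebraHom (Braided.envelopingData c b q) S g ∧
          ∀ v : V, g (Braided.envelopingι c b q v) = f v := by
  have h0 := Braided.canonicalBracket_eq_zero hS hchar hq0 hq1 hq3 hHecke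
  refine ⟨h0, fun c b hc hq hb => ⟨Braided.isBraidedBialgebra_envelopingData hc hq hb,
    Braided.isBialgebraHom_proj hc hq hb, fun f hf => ?_⟩⟩
  -- The zero bracket on `P` is the canonical one, so `f` satisfies the hypothesis of the general
  -- universal property.
  rw [← h0] at hf
  exact Braided.existsUnique_lift hS hHecke hc hq hb hf
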